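/- **Construction.** Let $d\ge 1$ and $N\ge 2$ be integers, $\epsilon\in[0,1)$, $\gamma\in(0,1)$. For $k\ge1$ put $N_k=N^k$, $M_k=N_1\cdots N_k$, $\delta_k=1/M_k$, and $\epsilon_k=\epsilon$ if $\epsilon>0$, $\epsilon_k=\gamma/k$ if $\epsilon=0$; let $p_k=N_k^{-d\epsilon_k}$. A multi-index of length $k$ is $\mathbf i=(i_1,\dots,i_k)$ with $i_j\in\{0,\dots,N_j-1\}^d$, and $Q(\mathbf i)=\sum_{j=1}^k i_j/M_j+[0,\delta_k]^d$. Let $\Omega$ be the set of all families $\omega=(Y_k(\mathbf i))$, with $k\ge1$, $\mathbf i$ a multi-index of length $k$ and $Y_k(\mathbf i)\in\{0,1\}$, with the product $\sigma$-algebra $\mathcal B$, and let $\mathbb P$ be the product measure under which all $Y_k(\mathbf i)$ are independent and $Y_k(\mathbf i)=1$ with probability $p_k$. Let $E_0=[0,1]^d$, let $E_k=E_k(\omega)$ be the union of the cubes $Q(i_1,\dots,i_k)$ with $Y_1(i_1)Y_2(i_1,i_2)\cdots Y_k(i_1,\dots,i_k)=1$, and let $E=E(\omega)=\bigcap_k E_k\subseteq[0,1]^d$.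 Let $\mathbb P^*=\mathbb P(\,\cdot\mid E\ne\emptyset)$. Let $\mu_k=\mu_k(\omega)$ be the normalized Lebesgue measure on $E_k$. For $R>0$ put $\Phi_R(t)=\exp(R\sqrt{\log t})$ for $t\ge1$ and $\Phi_R(t)=1$ for $0<t<1$. $B(x;r)$ is the Euclidean ball. **Theorem.** Let $n\ge2$ and $1\le d\le n$ be integers, let $\epsilon,N,\gamma$ be as above, and let $\alpha=d(1-\epsilon)$. Then $\mathbb P(E\neq\emptyset)>0$, so that $(\Omega,\mathcal B,\mathbb P^*)$ is a probability space, and there are Borel probability measures $\mu=\mu(\omega)$ on $\mathbb R^d$ $(\omega\in\Omega)$ and a constant $C_1>0$ that depends on $n,d,\epsilon,N,\gamma$ but not on $\omega$, such that for $\mathbb P^*$-almost every $\omega$: the measure $\mu$ is carried by $E$, $\mu_k\to\mu$ in the weak-$*$ topology, and (a) $\dim_{\mathbb H}E=d(1-\epsilon)$; if $\epsilon=0$, then $\mu$ is singular with respect to the $d$-dimensional Lebesgue measure. (b) There is $C_2=C_2(\omega)>0$ such that $$\mu(B(x;r))\,r^{-\alpha}\,[\Phi_{C_1}(1/r)]^{-1}\le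 C_2\qquad\text{for all }x\in[0,1]^d,\ r>0 .$$ Moreover, for every compact $n$-dimensional Riemannian manifold $(M,g)$ and every smooth embedding $\mathfrak u:U\to M$ of an open set $U\subseteq\mathbb R^d$ containing $[0,1]^d$ (for instance, a chart of an embedded $d$-dimensional submanifold $\Sigma\subseteq M$), the measure $\nu(A)=\mu(\mathfrak u^{-1}(A))$ satisfies $\sup\{\nu(B_g(x;r))/(r^{\alpha}\Phi_{C_1}(1/r)):x\in M,\ r>0\}<\infty$, where $B_g$ denotes Riemannian balls in $M$. (c) For every $v_0\in E$ there is $C_0=C_0(v_0,\omega)>0$ such that $$\mu(B(v_0;r))\,r^{-\alpha}\,\Phi_{C_1}(1/r)\ge C_0^{-1}\qquad\text{for all }0<r<1,$$ and such that, for all $M$, $\mathfrak u$ and $\nu$ as in (b), with $y_0=\mathfrak u(v_0)$, $$\limsup_{r\to0+}\ r^{-\alpha}\,\Phi_{C_1}(1/r)\,\nu(B_g(y_0;r))\ \ge\ C_0^{-1}>0 .$$ -/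

import Mathlib

open Set Filter Topology MeasureTheory ProbabilityTheory
open scoped ENNReal Bundle BoundedContinuousFunction

universe v

namespace RandomCantor

/-! ### Cantor-type construction

Throughout, `b : ℕ → ℕ` is the sequence of branching numbers; only `b 1, b 2, …` are used. -/

/-- The closed unit cube `[0,1]^d`. -/
def unitCube (d : ℕ) : Set (EuclideanSpace ℝ (Fin d)) :=
  {x | ∀ a, 0 ≤ x a ∧ x a ≤ 1}

/-- Multi-indices `(i_1, …, i_k)` with `i_j ∈ {0, …, b j - 1}^d`; the digit `i_j` is stored at
position `j - 1`, and the digits start from `0` (instead of starting from `1` and subtracting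
`1` in the digit expansion). -/
abbrev MultiIndex (b : ℕ → ℕ) (d k : ℕ) : Type :=
  (j : Fin k) → Fin d → Fin (b (j + 1))

/-- The first `m` digits of a multi-index of length `k ≥ m`. -/
def MultiIndex.trunc {b : ℕ → ℕ} {d k m : ℕ} (h : m ≤ k) (i : MultiIndex b d k) :
    MultiIndex b d m :=
  fun j => i (Fin.castLE h j)

/-- `M_k = b 1 * b 2 * ⋯ * b k`. -/
def bigM (b : ℕ → ℕ) (k : ℕ) : ℕ := ∏ j ∈ Finset.range k, b (j + 1)

/-- The side length `δ_k = 1 / M_k` of the cubes of generation `k`. -/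
noncomputable def sideLength (b : ℕ → ℕ) (k : ℕ) : ℝ := 1 / (bigM b k : ℝ)

/-- Coordinates of the corner `α(i_1, …, i_k) = i_1 / M_1 + ⋯ + i_k / M_k`. -/
noncomputable def corner {b : ℕ → ℕ} {d k : ℕ} (i : MultiIndex b d k) (a : Fin d) : ℝ :=
  ∑ j : Fin k, ((i j a : ℕ) : ℝ) / (bigM b (j + 1) : ℝ)

/-- The closed cube `Q(i) = α(i) + [0, δ_k]^d`. -/
def cube {b : ℕ → ℕ} {d k : ℕ} (i : MultiIndex b d k) : Set (EuclideanSpace ℝ (Fin d)) :=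
  {x | ∀ a, corner i a ≤ x a ∧ x a ≤ corner i a + sideLength b k}

/-- The sample space: `ω = (Y_1, Y_2, …)`, where `Y_k` is a binary string indexed by the
multi-indices of length `k`. The string `Y_{k+1}` is `ω k`. -/
abbrev Sample (b : ℕ → ℕ) (d : ℕ) : Type :=
  (k : ℕ) → MultiIndex b d (k + 1) → Bool

/-- `X_k(i) = 1`, where `X_k(i_1, …, i_k) = Y_1(i_1) Y_2(i_1, i_2) ⋯ Y_k(i_1, …, i_k)`. -/
def Selected {b : ℕ → ℕ} {d k : ℕ} (ω : Sample b d) (i : MultiIndex b d k) : Prop :=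
  ∀ (m : ℕ) (hm : m < k), ω m (MultiIndex.trunc (Nat.succ_le_of_lt hm) i) = true

/-- `E_k(ω)`, the union of the selected cubes of generation `k`. -/
def prefractal {b : ℕ → ℕ} {d : ℕ} (ω : Sample b d) (k : ℕ) :
    Set (EuclideanSpace ℝ (Fin d)) :=
  ⋃ (i : MultiIndex b d k) (_ : Selected ω i), cube i

/-- The Cantor-type set `E(ω) = ⋂ E_k(ω)`. -/
def cantorSet {b : ℕ → ℕ} {d : ℕ} (ω : Sample b d) : Set (EuclideanSpace ℝ (Fin d)) :=
  ⋂ k : ℕ, prefractal ω k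

/-- `μ_k`, the normalized Lebesgue measure on `E_k(ω)`. -/
noncomputable def prefractalMeasure {b : ℕ → ℕ} {d : ℕ} (ω : Sample b d) (k : ℕ) :
    Measure (EuclideanSpace ℝ (Fin d)) :=
  ProbabilityTheory.cond volume (prefractal ω k)

/-- `μ` is the Cantor measure of `E(ω)`: a probability measure carried by `E(ω)` that is the
weak-* limit of the measures `μ_k`. (There is at most one such measure.) -/
def IsCantorMeasure {b : ℕ → ℕ} {d : ℕ} (ω : Sample b d)
    (μ : ProbabilityMeasure (EuclideanSpace ℝ (Fin d))) : Prop :=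
  (μ : Measure (EuclideanSpace ℝ (Fin d))) (cantorSet ω)ᶜ = 0 ∧
  ∀ f : EuclideanSpace ℝ (Fin d) →ᵇ ℝ,
    Tendsto (fun k => ∫ x, f x ∂(prefractalMeasure ω k)) atTop
      (𝓝 (∫ x, f x ∂(μ : Measure (EuclideanSpace ℝ (Fin d)))))

/-! ### The random selection -/

/-- The selection probability `p_k = b_k ^ (-d e_k)`. The projection to `[0,1]` changes nothing
for `b k ≥ 1` and `e k ≥ 0`, see `coe_selProb`. -/
noncomputable def selProb (b : ℕ → ℕ) (e : ℕ → ℝ) (d k : ℕ) : unitInterval :=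
  Set.projIcc (0 : ℝ) 1 zero_le_one ((b k : ℝ) ^ (-((d : ℝ) * e k)))

theorem coe_selProb {b : ℕ → ℕ} {e : ℕ → ℝ} {d k : ℕ} (hb : 1 ≤ b k) (he : 0 ≤ e k) :
    (selProb b e d k : ℝ) = (b k : ℝ) ^ (-((d : ℝ) * e k)) := by
  have hb' : (1 : ℝ) ≤ b k := by exact_mod_cast hb
  have h0 : (0 : ℝ) ≤ (b k : ℝ) ^ (-((d : ℝ) * e k)) := by positivity
  have h1 : (b k : ℝ) ^ (-((d : ℝ) * e k)) ≤ 1 :=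
    Real.rpow_le_one_of_one_le_of_nonpos hb' (by
      have : 0 ≤ (d : ℝ) * e k := by positivity
      linarith)
  simp [selProb, Set.coe_projIcc, h0, h1]

/-- The product probability measure `ℙ`: all the entries `Y_k(i)` are independent, and `Y_k(i)`
is a Bernoulli variable with success probability `p_k`. -/
noncomputable def auxProb (b : ℕ → ℕ) (e : ℕ → ℝ) (d : ℕ) : Measure (Sample b d) :=
  Measure.infinitePi fun k : ℕ =>
    Measure.pi fun _ : MultiIndex b d (k + 1) => bernoulliMeasure true false (selProb b e d (k + 1))

/-- `ℙ*`, which is `ℙ` conditioned on the event that `E` is not empty. -/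
noncomputable def condProb (b : ℕ → ℕ) (e : ℕ → ℝ) (d : ℕ) : Measure (Sample b d) :=
  ProbabilityTheory.cond (auxProb b e d) {ω | (cantorSet ω).Nonempty}

/-! ### The parameters -/

/-- `N_k = N ^ k`. -/
def branching (N : ℕ) (k : ℕ) : ℕ := N ^ k

/-- `ε_k = ε` if `ε > 0`, and `ε_k = γ / k` if `ε = 0`. -/
noncomputable def epsSeq (ε γ : ℝ) (k : ℕ) : ℝ :=
  open Classical in if ε = 0 then γ / (k : ℝ) else ε

/-- `Φ_R(t) = exp (R √(log t))` for `t ≥ 1`; since `√s = 0` for `s ≤ 0` in Lean, it is extended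
by the value `1` to `0 < t < 1`. -/
noncomputable def Phi (R t : ℝ) : ℝ := Real.exp (R * √(Real.log t))

/-! ### Transport to submanifolds -/

section Transport

open scoped ContDiff Manifold

/-- The measure `ν(A) = μ(u⁻¹(A))` on `M` induced by a map `u : U → M`. -/
noncomputable def chartMeasure {d : ℕ} {M : Type*} [MeasurableSpace M]
    {U : TopologicalSpace.Opens (EuclideanSpace ℝ (Fin d))} (u : U → M)
    (μ : Measure (EuclideanSpace ℝ (Fin d))) : Measure M :=
  Measure.map u (μ.comap (Subtype.val : U → EuclideanSpace ℝ (Fin d)))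

/-- For every compact `n`-dimensional Riemannian manifold `M` and every smooth embedding `u` into
`M` of an open set `U ⊆ ℝ^d` with `[0,1]^d ⊆ U`, the induced measure `ν` satisfies
`sup_{x, r} ν(B_g(x; r)) / (r^α Ψ(1/r)) < ∞`.

A chart `U → Σ` of an embedded submanifold `Σ ⊆ M` is such a map `u`, and the centres `x` range
over all of `M`, not only over `Σ`. -/
def ChartBallCondition (n d : ℕ) (α : ℝ) (Ψ : ℝ → ℝ)
    (μ : Measure (EuclideanSpace ℝ (Fin d))) : Prop :=
  ∀ (M : Type v) [EMetricSpace M] [CompactSpace M] [MeasurableSpace M] [BorelSpace M]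
    [ChartedSpace (EuclideanSpace ℝ (Fin n)) M] [IsManifold (𝓡 n) ∞ M]
    [Bundle.RiemannianBundle (fun x : M => TangentSpace (𝓡 n) x)]
    [IsContMDiffRiemannianBundle (𝓡 n) ∞ (EuclideanSpace ℝ (Fin n))
      (fun x : M => TangentSpace (𝓡 n) x)]
    [IsRiemannianManifold (𝓡 n) M]
    (U : TopologicalSpace.Opens (EuclideanSpace ℝ (Fin d))) (u : U → M),
    unitCube d ⊆ (U : Set (EuclideanSpace ℝ (Fin d))) →
    Manifold.IsSmoothEmbedding (𝓡 d) (𝓡 n) ∞ u →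
    ∃ C : ℝ, 0 < C ∧ ∀ (x : M) (r : ℝ), 0 < r →
      chartMeasure u μ (Metric.eball x (ENNReal.ofReal r))
        ≤ ENNReal.ofReal (C * (r ^ α * Ψ (1 / r)))

/-- With `M`, `u` and `ν` as in `ChartBallCondition`: at the point `y₀ = u(v₀)`,
`limsup_{r → 0+} r^{-α} Ξ(1/r) ν(B_g(y₀; r)) ≥ κ`. -/
def ChartLowerCondition (n d : ℕ) (α : ℝ) (Ξ : ℝ → ℝ)
    (μ : Measure (EuclideanSpace ℝ (Fin d))) (v₀ : EuclideanSpace ℝ (Fin d)) (κ : ℝ) : Prop :=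
  ∀ (M : Type v) [EMetricSpace M] [CompactSpace M] [MeasurableSpace M] [BorelSpace M]
    [ChartedSpace (EuclideanSpace ℝ (Fin n)) M] [IsManifold (𝓡 n) ∞ M]
    [Bundle.RiemannianBundle (fun x : M => TangentSpace (𝓡 n) x)]
    [IsContMDiffRiemannianBundle (𝓡 n) ∞ (EuclideanSpace ℝ (Fin n))
      (fun x : M => TangentSpace (𝓡 n) x)]
    [IsRiemannianManifold (𝓡 n) M]
    (U : TopologicalSpace.Opens (EuclideanSpace ℝ (Fin d))) (u : U → M),
    unitCube d ⊆ (U : Set (EuclideanSpace ℝ (Fin d))) →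
    Manifold.IsSmoothEmbedding (𝓡 d) (𝓡 n) ∞ u →
    ∀ w : U, (w : EuclideanSpace ℝ (Fin d)) = v₀ →
      ENNReal.ofReal κ ≤
        limsup (fun r : ℝ => ENNReal.ofReal (r ^ (-α) * Ξ (1 / r)) *
          chartMeasure u μ (Metric.eball (u w) (ENNReal.ofReal r))) (𝓝[>] 0)

end Transport

end RandomCantor

/-! Probability enters only through one condition on `ω`, namely `Controlled`. Every multi-index of
length `k`, selected or not, retains a binomial number of extensions, with mean `N^(d(1-ε)(k+1))` if
`ε > 0` and `N^(d(k+1)-dγ)` if `ε = 0`. This mean grows exponentially in `k`, while there are only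
`M_k^d = exp(O(k²))` indices. By a Chernoff bound and a union bound, the probabilities that some
index misses its mean by a relative error of more than about `1/(k+2)²` are summable
(`levelLaw_compl_goodStrings_le`, `summable_failureBound`). Borel–Cantelli then gives control from
some generation on almost surely (`ae_exists_controlled`), and making finitely many levels full
shows that survival has positive probability (`auxProb_cantorSet_nonempty_ne_zero`).

The rest is deterministic (`cantorSet_properties`). Let `Z_k` be the number of selected cubes of
generation `k`. The tolerances telescope, so each selected cube of generation `k` has the share
`1/Z_k` of the cubes of generation `l`, up to a factor `tol k ^ 2` or its inverse, which tends to
`1` uniformly in `l`. Therefore the integrals against `μ_l` are Cauchy, and tightness produces the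
limit `μ` (`Controlled.exists_isCantorMeasure`). For it, balls of radius at most `δ_k` have mass at
most `4^(d+1)/Z_k`, and selected cubes have mass at least `1/(4 Z_k)`. Moreover `Z_k` is comparable
with the product of the means, which is `δ_k^(-α)`, times `N^(-dγk)` if `ε = 0`.

Consecutive side lengths differ by the factor `N^(k+1)`, and `k log N ≤ √(2 log N · log(1/r))` when
`r ≤ δ_k`. Thus both the gap between scales and the factor `N^(-dγk)` are absorbed by `Φ_R`
(`exists_measure_ball_le`, `exists_le_measure_ball`). The dimension follows from the obvious
covering and from the mass distribution principle, because `Φ_R` grows more slowly than any power;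
singularity follows from `Z_k δ_k^d → 0`. Transport to `M` needs an inverse Lipschitz bound for the
embedding on the cube and a Lipschitz bound at one point. -/

namespace RandomCantor

/-! ### Charts are locally Lipschitz for the Riemannian distance. -/

section LocalLipschitz
open Manifold
open scoped ContDiff Manifold NNReal

attribute [local instance] normedAddCommGroupTangentSpaceVectorSpace
attribute [local instance] normedSpaceTangentSpaceVectorSpace

variable {E : Type*} [NormedAddCommGroup E] [NormedSpace ℝ E]
  {H : Type*} [TopologicalSpace H] {I : ModelWithCorners ℝ E H}
  {M : Type*} [TopologicalSpace M] [ChartedSpace H M] [IsManifold I 1 M]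
  [Bundle.RiemannianBundle (fun x : M => TangentSpace I x)]
  [IsContinuousRiemannianBundle E (fun x : M => TangentSpace I x)]

theorem eventually_enorm_mfderiv_extChartAt_apply_le (x : M) :
    ∃ C : ℝ≥0, 0 < C ∧ ∀ᶠ y in 𝓝 x, ∀ v : TangentSpace I y,
      ‖(mfderiv% (extChartAt I x) y v : E)‖ₑ ≤ C * ‖v‖ₑ := by
  rcases eventually_enorm_mfderiv_extChartAt_lt I x with ⟨C, C_pos, hC⟩
  refine ⟨C, C_pos, ?_⟩
  filter_upwards [hC] with y hy v
  refine le_trans (ContinuousLinearMap.le_opENorm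
    (mfderiv% (extChartAt I x) y : TangentSpace I y →L[ℝ] E) v) ?_
  gcongr
  exact hy.le

/-- The derivative of the chart is bounded on a Riemannian ball of radius `c` about `x`. Two points
within `c / 3` of `x` are joined by a path of length less than `2c / 3`, which cannot leave that
ball, so the derivative bound can be integrated along it. Both points vary while the chart stays
centred at `x`. -/
theorem eventually_edist_extChartAt_le_riemannianEDist [RegularSpace M] (x : M) :
    ∃ C : ℝ≥0, 0 < C ∧ ∀ᶠ p : M × M in 𝓝 (x, x),
      edist (extChartAt I x p.1) (extChartAt I x p.2) ≤ C * riemannianEDist I p.1 p.2 := by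
  rcases eventually_enorm_mfderiv_extChartAt_apply_le (I := I) x with ⟨C, C_pos, hC⟩
  have hmem := Filter.inter_mem hC (chart_source_mem_nhds H x)
  rcases setOfPred_riemannianEDist_lt_subset_nhds I hmem with ⟨c, c_pos, hc⟩
  refine ⟨C, C_pos, ?_⟩
  have hc3 : (0 : ℝ≥0∞) < c / 3 := ENNReal.div_pos (by simpa using c_pos.ne') (by simp)
  have hball := eventually_riemannianEDist_lt I x hc3
  rw [nhds_prod_eq]
  filter_upwards [hball.prod_mk hball] with p hp
  obtain ⟨h1, h2⟩ := hp
  have h12 : riemannianEDist I p.1 p.2 < c / 3 + c / 3 := by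
    refine (riemannianEDist_triangle (y := x)).trans_lt ?_
    rw [riemannianEDist_comm (x := p.1)]
    exact ENNReal.add_lt_add h1 h2
  refine le_of_forall_gt fun r hr => ?_
  have hCtop : (C : ℝ≥0∞) ≠ ⊤ := ENNReal.coe_ne_top
  have hC0 : (C : ℝ≥0∞) ≠ 0 := by simpa using C_pos.ne'
  have hr' : riemannianEDist I p.1 p.2 < r / C := by
    rw [ENNReal.lt_div_iff_mul_lt (Or.inl hC0) (Or.inl hCtop), mul_comm]
    exact hr
  obtain ⟨γ, γ0, γ1, γs, hγ, -⟩ :=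
    exists_lt_locally_constant_of_riemannianEDist_lt (lt_min hr' h12) zero_lt_one
  have hin : ∀ t ∈ Icc (0 : ℝ) 1, (∀ v : TangentSpace I (γ t),
      ‖(mfderiv% (extChartAt I x) (γ t) v : E)‖ₑ ≤ C * ‖v‖ₑ) ∧ γ t ∈ (chartAt H x).source := by
    intro t ht
    refine hc (?_ : γ t ∈ {y | riemannianEDist I x y < c})
    show riemannianEDist I x (γ t) < c
    calc riemannianEDist I x (γ t)
        ≤ riemannianEDist I x p.1 + riemannianEDist I p.1 (γ t) := riemannianEDist_triangle
      _ ≤ riemannianEDist I x p.1 + pathELength I γ 0 1 := by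
          gcongr
          exact (riemannianEDist_le_pathELength γs.contMDiffOn γ0 rfl ht.1).trans
            (pathELength_mono le_rfl ht.2)
      _ < c / 3 + (c / 3 + c / 3) :=
          ENNReal.add_lt_add h1 (hγ.trans_le (min_le_right _ _))
      _ = c := by rw [← add_assoc, ENNReal.add_thirds]
  let γ' := extChartAt I x ∘ γ
  have hC' : CMDiff[Icc 0 1] 1 γ' :=
    contMDiffOn_extChartAt.comp (I' := I) (t := (chartAt H x).source)
      γs.contMDiffOn (fun t' ht' ↦ (hin t' ht').2)
  rw [edist_comm, edist_eq_enorm_sub]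
  calc
      ‖extChartAt I x p.2 - extChartAt I x p.1‖ₑ = ‖γ' 1 - γ' 0‖ₑ := by
        simp [γ', γ0, γ1]
    _ ≤ ∫⁻ t' in Icc 0 1, ‖derivWithin γ' (Icc 0 1) t'‖ₑ := by
      apply enorm_sub_le_lintegral_derivWithin_Icc_of_contDiffOn_Icc _ zero_le_one
      rwa [← contMDiffOn_iff_contDiffOn]
    _ = ∫⁻ t' in Icc 0 1, ‖mfderiv[Icc 0 1] γ' t' 1‖ₑ := by
      simp_rw [← fderivWithin_derivWithin, mfderivWithin_eq_fderivWithin]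
      rfl
    _ ≤ ∫⁻ t' in Icc 0 1, C * ‖mfderiv[Icc 0 1] γ t' 1‖ₑ := by
      apply setLIntegral_mono' measurableSet_Icc (fun t' ht' ↦ ?_)
      have : mfderiv[Icc 0 1] γ' t' =
          (mfderiv% (extChartAt I x) (γ t')) ∘L (mfderiv[Icc 0 1] γ t') := by
        apply mfderiv_comp_mfderivWithin
        · exact mdifferentiableAt_extChartAt (hin t' ht').2
        · exact (γs.mdifferentiable one_ne_zero).mdifferentiableOn _ ht'
        · rw [uniqueMDiffWithinAt_iff_uniqueDiffWithinAt]
          exact uniqueDiffOn_Icc zero_lt_one _ ht'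
      have : mfderiv[Icc 0 1] γ' t' 1 =
          (mfderiv% (extChartAt I x) (γ t')) (mfderiv[Icc 0 1] γ t' 1) :=
        congr($this 1)
      rw [this]
      exact (hin t' ht').1 _
    _ = C * pathELength I γ 0 1 := by
      rw [lintegral_const_mul' _ _ ENNReal.coe_ne_top,
          pathELength_eq_lintegral_mfderivWithin_Icc]
    _ < C * (r / C) := by
      gcongr
      exact hγ.trans_le (min_le_left _ _)
    _ = r := ENNReal.mul_div_cancel hC0 hCtop

end LocalLipschitz
theorem isContinuousRiemannianBundle_of_isContMDiff
    {EB : Type*} [NormedAddCommGroup EB] [NormedSpace ℝ EB]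
    {HB : Type*} [TopologicalSpace HB] (IB : ModelWithCorners ℝ EB HB) (k : WithTop ℕ∞)
    {B : Type*} [TopologicalSpace B] [ChartedSpace HB B]
    {F : Type*} [NormedAddCommGroup F] [NormedSpace ℝ F]
    {V : B → Type*} [TopologicalSpace (Bundle.TotalSpace F V)] [∀ x, NormedAddCommGroup (V x)]
    [∀ x, InnerProductSpace ℝ (V x)] [FiberBundle F V] [VectorBundle ℝ F V]
    [h : IsContMDiffRiemannianBundle IB k F V] : IsContinuousRiemannianBundle F V := by
  obtain ⟨g, hg, hgi⟩ := h.exists_contMDiff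
  exact ⟨g, hg.continuous, hgi⟩

/-! ### Lipschitz and inverse Lipschitz bounds for smooth embeddings. -/

section SmoothEmbedding
open Manifold
open scoped ContDiff Manifold NNReal

variable {n d : ℕ} {M : Type*} [EMetricSpace M]
    [ChartedSpace (EuclideanSpace ℝ (Fin n)) M] [IsManifold (𝓡 n) ∞ M]
    [Bundle.RiemannianBundle (fun x : M => TangentSpace (𝓡 n) x)]
    [IsContMDiffRiemannianBundle (𝓡 n) ∞ (EuclideanSpace ℝ (Fin n))
      (fun x : M => TangentSpace (𝓡 n) x)]
    [IsRiemannianManifold (𝓡 n) M]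

theorem eventually_edist_le_of_contMDiffAt {F : Type*} [NormedAddCommGroup F] [NormedSpace ℝ F]
    {g : M → F} {x : M} (hg : ContMDiffAt (𝓡 n) 𝓘(ℝ, F) 1 g x) :
    ∃ C : ℝ≥0, 0 < C ∧ ∀ᶠ p : M × M in 𝓝 (x, x),
      edist (g p.1) (g p.2) ≤ C * edist p.1 p.2 := by
  have : IsManifold (𝓡 n) 1 M := .of_le (n := ∞) (by exact_mod_cast le_top)
  have : IsContinuousRiemannianBundle (EuclideanSpace ℝ (Fin n))
      (fun x : M => TangentSpace (𝓡 n) x) :=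
    isContinuousRiemannianBundle_of_isContMDiff (𝓡 n) ∞
  obtain ⟨C, hC, h⟩ := eventually_edist_extChartAt_le_riemannianEDist (I := 𝓡 n) x
  have h2 := (contMDiffAt_iff.1 hg).2
  simp only [modelWithCornersSelf_coe, range_id, contDiffWithinAt_univ] at h2
  obtain ⟨K, t, ht, hK⟩ := h2.exists_lipschitzOnWith
  -- The summand `1` only keeps the constant positive, since `K` may vanish.
  refine ⟨K * C + 1, by positivity, ?_⟩
  have hsrc : ∀ᶠ y in 𝓝 x, y ∈ (extChartAt (𝓡 n) x).source ∧ extChartAt (𝓡 n) x y ∈ t :=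
    Filter.Eventually.and
      (extChartAt_source_mem_nhds (I := 𝓡 n) x) ((continuousAt_extChartAt (I := 𝓡 n) x).eventually_mem ht)
  have hs2 : ∀ᶠ p : M × M in 𝓝 (x, x), (p.1 ∈ (extChartAt (𝓡 n) x).source ∧
      extChartAt (𝓡 n) x p.1 ∈ t) ∧ (p.2 ∈ (extChartAt (𝓡 n) x).source ∧
      extChartAt (𝓡 n) x p.2 ∈ t) := by
    rw [nhds_prod_eq]; exact hsrc.prod_mk hsrc
  filter_upwards [h, hs2] with p hp hq
  obtain ⟨⟨h1, h1'⟩, h2, h2'⟩ := hq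
  have := hK h1' h2'
  simp only [Function.comp_apply, extChartAt_model_space_eq_id, PartialEquiv.refl_coe, id,
    (extChartAt (𝓡 n) x).left_inv h1, (extChartAt (𝓡 n) x).left_inv h2] at this
  calc edist (g p.1) (g p.2) ≤ K * edist (extChartAt (𝓡 n) x p.1) (extChartAt (𝓡 n) x p.2) := this
    _ ≤ K * (C * edist p.1 p.2) := by
        gcongr
        rw [IsRiemannianManifold.out (I := 𝓡 n) p.1 p.2]
        exact hp
    _ ≤ _ := by
        rw [← mul_assoc]
        gcongr
        push_cast
        exact le_self_add

variable {U : TopologicalSpace.Opens (EuclideanSpace ℝ (Fin d))} {u : U → M}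

/-- One of the two points stays fixed at `w`; this suffices for the lower bound on balls centred at
`u w`. -/
theorem exists_eventually_edist_le_of_contMDiffAt {w : U}
    (hu : ContMDiffAt (𝓡 d) (𝓡 n) 1 u w) :
    ∃ L : ℝ≥0, 0 < L ∧ ∀ᶠ v in 𝓝 w, edist (u v) (u w) ≤
      L * edist (v : EuclideanSpace ℝ (Fin d)) w := by
  have : IsManifold (𝓡 n) 1 M := .of_le (n := ∞) (by exact_mod_cast le_top)
  have : IsContinuousRiemannianBundle (EuclideanSpace ℝ (Fin n))
      (fun x : M => TangentSpace (𝓡 n) x) :=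
    isContinuousRiemannianBundle_of_isContMDiff (𝓡 n) ∞
  obtain ⟨C, hC, h⟩ := eventually_riemannianEDist_le_edist_extChartAt (𝓡 n) (u w)
  obtain ⟨hc, h2⟩ := contMDiffAt_iff.1 hu
  simp only [modelWithCornersSelf_coe, range_id, contDiffWithinAt_univ] at h2
  obtain ⟨K, t, ht, hK⟩ := h2.exists_lipschitzOnWith
  refine ⟨C * K + 1, by positivity, ?_⟩
  have ht' : ∀ᶠ v in 𝓝 w, extChartAt (𝓡 d) w v ∈ t :=
    (continuousAt_extChartAt (I := 𝓡 d) w).eventually_mem ht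
  filter_upwards [hc.eventually h, ht', extChartAt_source_mem_nhds (I := 𝓡 d) w] with v hv hvt hvs
  have h3 := hK (mem_of_mem_nhds ht) hvt
  simp only [Function.comp_apply, (extChartAt (𝓡 d) w).left_inv hvs,
    (extChartAt (𝓡 d) w).left_inv (mem_extChartAt_source w)] at h3
  have h4 : edist (extChartAt (𝓡 d) w w) (extChartAt (𝓡 d) w v) =
      edist (v : EuclideanSpace ℝ (Fin d)) w := by
    rw [edist_comm]; rfl
  rw [h4] at h3
  rw [edist_comm, IsRiemannianManifold.out (I := 𝓡 n) (u w) (u v)]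
  calc _ ≤ _ := hv
    _ ≤ C * (K * edist (v : EuclideanSpace ℝ (Fin d)) w) := by gcongr
    _ ≤ _ := by
        rw [← mul_assoc]
        gcongr
        push_cast
        exact le_self_add

/-- In suitable charts an immersion is the inclusion of a factor. Projecting back onto this factor
gives a smooth local left inverse `G`, and its Lipschitz bound is the inverse bound for `u`. -/
theorem eventually_edist_le_edist_of_isImmersionAt {w : U}
    (hu : IsImmersionAt (𝓡 d) (𝓡 n) ∞ u w) :
    ∃ L : ℝ≥0, 0 < L ∧ ∀ᶠ p : U × U in 𝓝 (w, w),
      edist (p.1 : EuclideanSpace ℝ (Fin d)) p.2 ≤ L * edist (u p.1) (u p.2) := by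
  have hc : ContinuousAt u w := hu.contMDiffAt.continuousAt
  let G : M → EuclideanSpace ℝ (Fin d) := fun y =>
    ((hu.domChart.symm (hu.equiv.symm (hu.codChart y)).1 : U) : EuclideanSpace ℝ (Fin d))
  have hmem : ∀ v ∈ hu.domChart.source,
      hu.domChart v ∈ (hu.domChart.extend (𝓡 d)).target := fun v hv => by
    simpa using hu.domChart.map_source hv
  have hGu : ∀ v ∈ hu.domChart.source, G (u v) = v := by
    intro v hv
    have h1 := hu.writtenInCharts (hmem v hv)
    simp only [Function.comp_apply, OpenPartialHomeomorph.extend_coe, modelWithCornersSelf_coe,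
      id, OpenPartialHomeomorph.extend_coe_symm, modelWithCornersSelf_coe_symm,
      hu.domChart.left_inv hv] at h1
    simp only [G, h1, ContinuousLinearEquiv.symm_apply_apply, hu.domChart.left_inv hv]
  have hG : ContMDiffAt (𝓡 n) 𝓘(ℝ, EuclideanSpace ℝ (Fin d)) ∞ G (u w) := by
    have h1 : ContMDiffAt (𝓡 n) (𝓡 n) ∞ hu.codChart (u w) :=
      contMDiffAt_of_mem_maximalAtlas hu.codChart_mem_maximalAtlas hu.mem_codChart_source
    have h2 : ContMDiffAt (𝓡 n) (𝓡 d) ∞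
        (fun y : EuclideanSpace ℝ (Fin n) => (hu.equiv.symm y).1) (hu.codChart (u w)) :=
      ((contDiff_fst.comp hu.equiv.symm.contDiff).contMDiff).contMDiffAt
    have hpt : (hu.equiv.symm (hu.codChart (u w))).1 = hu.domChart w := by
      have h1 := hu.writtenInCharts (hmem w hu.mem_domChart_source)
      simp only [Function.comp_apply, OpenPartialHomeomorph.extend_coe, modelWithCornersSelf_coe,
        id, OpenPartialHomeomorph.extend_coe_symm, modelWithCornersSelf_coe_symm,
        hu.domChart.left_inv hu.mem_domChart_source] at h1
      simp only [h1, ContinuousLinearEquiv.symm_apply_apply]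
    have h3 : ContMDiffAt (𝓡 d) (𝓡 d) ∞ hu.domChart.symm
        (hu.equiv.symm (hu.codChart (u w))).1 := by
      rw [hpt]
      exact contMDiffAt_symm_of_mem_maximalAtlas hu.domChart_mem_maximalAtlas
        (hu.domChart.map_source hu.mem_domChart_source)
    have h4 : ContMDiff (𝓡 d) (𝓡 d) ∞ (Subtype.val : U → EuclideanSpace ℝ (Fin d)) :=
      contMDiff_subtype_val
    have h5 := h2.comp (u w) h1
    have h6 := ContMDiffAt.comp (u w) h3 h5
    exact ContMDiffAt.comp (u w) h4.contMDiffAt h6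
  obtain ⟨L, hL, h⟩ := eventually_edist_le_of_contMDiffAt (hG.of_le (by exact_mod_cast le_top))
  refine ⟨L, hL, ?_⟩
  have hs : ∀ᶠ v in 𝓝 w, v ∈ hu.domChart.source :=
    hu.domChart.open_source.mem_nhds hu.mem_domChart_source
  have hs2 : ∀ᶠ p : U × U in 𝓝 (w, w), p.1 ∈ hu.domChart.source ∧ p.2 ∈ hu.domChart.source := by
    rw [nhds_prod_eq]; exact hs.prod_mk hs
  have hcc : Tendsto (fun p : U × U => (u p.1, u p.2)) (𝓝 (w, w)) (𝓝 (u w, u w)) := by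
    rw [nhds_prod_eq, nhds_prod_eq]
    exact Tendsto.prodMap hc hc
  filter_upwards [hcc.eventually h, hs2] with p hp hps
  simpa only [hGu _ hps.1, hGu _ hps.2] using hp

/-- Compactness of `K ×ˢ K`: near the diagonal the immersion bound applies, and near a point off the
diagonal injectivity keeps `edist (u v) (u w)` away from zero while the other distance stays
bounded. -/
theorem exists_edist_le_edist_of_isSmoothEmbedding
    (hu : IsSmoothEmbedding (𝓡 d) (𝓡 n) ∞ u) {K : Set U} (hK : IsCompact K) :
    ∃ L : ℝ≥0, 0 < L ∧ ∀ v ∈ K, ∀ w ∈ K,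
      edist (v : EuclideanSpace ℝ (Fin d)) w ≤ L * edist (u v) (u w) := by
  let P : Set (U × U) → Prop := fun S => ∃ L : ℝ≥0, 0 < L ∧ ∀ p ∈ S,
      edist (p.1 : EuclideanSpace ℝ (Fin d)) p.2 ≤ L * edist (u p.1) (u p.2)
  suffices h : P (K ×ˢ K) by
    obtain ⟨L, hL, h⟩ := h
    exact ⟨L, hL, fun v hv w hw => h (v, w) ⟨hv, hw⟩⟩
  have huc : Continuous u := hu.isEmbedding.continuous
  refine (hK.prod hK).induction_on (p := P) ⟨1, one_pos, by simp⟩ ?_ ?_ ?_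
  · rintro s t hst ⟨L, hL, h⟩
    exact ⟨L, hL, fun p hp => h p (hst hp)⟩
  · rintro s t ⟨L, hL, h⟩ ⟨L', hL', h'⟩
    refine ⟨L + L', by positivity, fun p hp => ?_⟩
    rcases hp with hp | hp
    · refine (h p hp).trans ?_
      gcongr
      exact le_self_add
    · refine (h' p hp).trans ?_
      gcongr
      exact le_add_self
  · rintro ⟨v, w⟩ -
    by_cases hvw : v = w
    · subst hvw
      obtain ⟨L, hL, h⟩ := eventually_edist_le_edist_of_isImmersionAt (hu.isImmersion.isImmersionAt v)
      exact ⟨_, mem_nhdsWithin_of_mem_nhds h, L, hL, fun p hp => hp⟩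
    · have h0 : 0 < edist (u v) (u w) := by
        rw [edist_pos]; exact fun h => hvw (hu.isEmbedding.injective h)
      obtain ⟨c, hc0, hc⟩ : ∃ c : ℝ≥0, 0 < c ∧ (c : ℝ≥0∞) < edist (u v) (u w) := by
        obtain ⟨c, hc0, hc⟩ := ENNReal.lt_iff_exists_nnreal_btwn.1 h0
        exact ⟨c, by exact_mod_cast hc0, hc⟩
      obtain ⟨D, hD⟩ : ∃ D : ℝ≥0, edist (v : EuclideanSpace ℝ (Fin d)) w < D :=
        ⟨nndist (v : EuclideanSpace ℝ (Fin d)) w + 1, by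
          rw [edist_nndist]; exact_mod_cast lt_add_one _⟩
      have e1 : ∀ᶠ p : U × U in 𝓝 (v, w), (c : ℝ≥0∞) < edist (u p.1) (u p.2) :=
        (((huc.comp continuous_fst).edist (huc.comp continuous_snd)).continuousAt
          (x := (v, w))).eventually_const_lt hc
      have e2 : ∀ᶠ p : U × U in 𝓝 (v, w),
          edist (p.1 : EuclideanSpace ℝ (Fin d)) p.2 < D :=
        (((continuous_subtype_val.comp continuous_fst).edist
          (continuous_subtype_val.comp continuous_snd)).continuousAt
          (x := (v, w))).eventually_lt_const hD
      have hD0 : 0 < D := by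
        have := (zero_le).trans_lt hD
        exact_mod_cast this
      refine ⟨_, mem_nhdsWithin_of_mem_nhds (e1.and e2), D / c, by positivity, fun p hp => ?_⟩
      calc edist (p.1 : EuclideanSpace ℝ (Fin d)) p.2 ≤ D := hp.2.le
        _ = (D / c : ℝ≥0) * (c : ℝ≥0) := by
            rw [← ENNReal.coe_mul, div_mul_cancel₀ _ hc0.ne']
        _ ≤ _ := by gcongr; exact hp.1.le

end SmoothEmbedding
-- Combinatorics and geometry of the cubes.
section Digits

variable {b : ℕ → ℕ} {d : ℕ}

theorem bigM_succ (b : ℕ → ℕ) (k : ℕ) : bigM b (k + 1) = bigM b k * b (k + 1) :=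
  Finset.prod_range_succ _ _

theorem bigM_pos (hb : ∀ k, 0 < b (k + 1)) (k : ℕ) : 0 < bigM b k :=
  Finset.prod_pos fun _ _ => hb _

theorem sideLength_pos (hb : ∀ k, 0 < b (k + 1)) (k : ℕ) : 0 < sideLength b k := by
  have := bigM_pos hb k
  unfold sideLength
  positivity

/-- The numerators of the coordinates of the corner of a cube, as multiples of the side length. -/
def cornerNum : {k : ℕ} → MultiIndex b d k → Fin d → ℕ
  | 0, _, _ => 0
  | k + 1, i, a => cornerNum (MultiIndex.trunc (Nat.le_succ k) i) a * b (k + 1) + i (Fin.last k) a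

theorem trunc_self {k : ℕ} (h : k ≤ k) (i : MultiIndex b d k) : MultiIndex.trunc h i = i := rfl

theorem eq_of_trunc_eq {k : ℕ} {i j : MultiIndex b d (k + 1)}
    (h : MultiIndex.trunc (Nat.le_succ k) i = MultiIndex.trunc (Nat.le_succ k) j)
    (h' : i (Fin.last k) = j (Fin.last k)) : i = j := by
  funext m
  refine Fin.lastCases h' (fun m => ?_) m
  exact congrFun h m

theorem corner_succ {k : ℕ} (i : MultiIndex b d (k + 1)) (a : Fin d) :
    corner i a = corner (MultiIndex.trunc (Nat.le_succ k) i) a +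
      ((i (Fin.last k) a : ℕ) : ℝ) / (bigM b (k + 1) : ℝ) := by
  simp only [corner, Fin.sum_univ_castSucc]
  rfl

theorem corner_eq_cornerNum_div (hb : ∀ k, 0 < b (k + 1)) {k : ℕ} (i : MultiIndex b d k)
    (a : Fin d) : corner i a = cornerNum i a / bigM b k := by
  induction k with
  | zero => simp [corner, cornerNum]
  | succ k ih =>
    have h1 : (0 : ℝ) < bigM b k := by exact_mod_cast bigM_pos hb k
    have h2 : (0 : ℝ) < b (k + 1) := by exact_mod_cast hb k
    rw [corner_succ, ih]
    simp only [cornerNum, bigM_succ]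
    push_cast
    field_simp

/-- Uniqueness of mixed-radix digits: quotient and remainder modulo `b (k + 1)` recover the earlier
numerators and the last digit. -/
theorem cornerNum_injective {k : ℕ} :
    Function.Injective (cornerNum : MultiIndex b d k → Fin d → ℕ) := by
  induction k with
  | zero => intro i j _; funext m; exact m.elim0
  | succ k ih =>
    intro i j h
    have key : ∀ a, cornerNum (MultiIndex.trunc (Nat.le_succ k) i) a =
        cornerNum (MultiIndex.trunc (Nat.le_succ k) j) a ∧
        (i (Fin.last k) a : ℕ) = j (Fin.last k) a := by
      intro a
      have ha := congrFun h a
      simp only [cornerNum] at ha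
      have hi := (i (Fin.last k) a).isLt
      have hj := (j (Fin.last k) a).isLt
      simp only [Fin.val_last] at hi hj
      have e1 := congrArg (· / b (k + 1)) ha
      have e2 := congrArg (· % b (k + 1)) ha
      have hpos : 0 < b (k + 1) := by omega
      simp only [Nat.mul_comm _ (b (k + 1)), Nat.mul_add_div hpos, Nat.mul_add_mod,
        Nat.div_eq_of_lt hi, Nat.div_eq_of_lt hj, Nat.mod_eq_of_lt hi, Nat.mod_eq_of_lt hj] at e1 e2
      exact ⟨by simpa using e1, e2⟩
    refine eq_of_trunc_eq (ih (funext fun a => (key a).1)) (funext fun a => Fin.ext (key a).2)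

theorem card_multiIndex (k : ℕ) : Fintype.card (MultiIndex b d k) = bigM b k ^ d := by
  simp [MultiIndex, Fintype.card_pi, bigM, Finset.prod_range, Finset.prod_pow]

theorem card_extensions {k : ℕ} (i : MultiIndex b d k) :
    (Finset.univ.filter fun j : MultiIndex b d (k + 1) =>
      MultiIndex.trunc (Nat.le_succ k) j = i).card = b (k + 1) ^ d := by
  have : (Finset.univ : Finset (Fin d → Fin (b (k + 1)))).card = b (k + 1) ^ d := by
    simp
  rw [← this]
  refine (Finset.card_bij' (fun x _ => (Fin.snoc (α := fun j : Fin (k + 1) =>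
    Fin d → Fin (b (j + 1))) i x : MultiIndex b d (k + 1)))
    (fun j _ => j (Fin.last k)) ?_ ?_ ?_ ?_).symm
  · intro x _
    simp only [Finset.mem_filter, Finset.mem_univ, true_and]
    funext m
    exact Fin.snoc_castSucc (α := fun j : Fin (k + 1) => Fin d → Fin (b (j + 1))) x i m
  · simp
  · intro x _
    exact Fin.snoc_last (α := fun j : Fin (k + 1) => Fin d → Fin (b (j + 1))) x i
  · intro j hj
    simp only [Finset.mem_filter, Finset.mem_univ, true_and] at hj
    apply eq_of_trunc_eq
    · rw [hj]; funext m
      exact Fin.snoc_castSucc (α := fun j : Fin (k + 1) => Fin d → Fin (b (j + 1))) _ i m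
    · exact Fin.snoc_last (α := fun j : Fin (k + 1) => Fin d → Fin (b (j + 1))) _ i

theorem cube_subset_cube_trunc_succ (hb : ∀ k, 0 < b (k + 1)) {k : ℕ} (i : MultiIndex b d (k + 1)) :
    cube i ⊆ cube (MultiIndex.trunc (Nat.le_succ k) i) := by
  intro x hx a
  obtain ⟨h1, h2⟩ := hx a
  rw [corner_succ] at h1 h2
  have p1 : (0 : ℝ) < bigM b k := by exact_mod_cast bigM_pos hb k
  have p2 : (0 : ℝ) < b (k + 1) := by exact_mod_cast hb k
  have hlt : ((i (Fin.last k) a : ℕ) : ℝ) + 1 ≤ b (k + 1) := by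
    exact_mod_cast (i (Fin.last k) a).isLt
  have e1 : ((i (Fin.last k) a : ℕ) : ℝ) / (bigM b (k + 1) : ℝ) + sideLength b (k + 1) ≤
      sideLength b k := by
    unfold sideLength
    rw [← add_div, bigM_succ, div_le_div_iff₀ (by push_cast; positivity) p1]
    push_cast
    nlinarith
  have e2 : 0 ≤ ((i (Fin.last k) a : ℕ) : ℝ) / (bigM b (k + 1) : ℝ) := by positivity
  constructor <;> linarith

theorem cube_subset_cube_trunc (hb : ∀ k, 0 < b (k + 1)) {k l : ℕ} (h : k ≤ l)
    (i : MultiIndex b d l) : cube i ⊆ cube (MultiIndex.trunc h i) := by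
  induction l, h using Nat.le_induction with
  | base => exact subset_rfl
  | succ l h ih => exact (cube_subset_cube_trunc_succ hb i).trans (ih _)

theorem cube_zero (i : MultiIndex b d 0) : cube i = unitCube d := by
  ext x; simp [cube, unitCube, corner, sideLength, bigM]

/-- The axis-parallel box with corners `l` and `u`. -/
def box (l u : Fin d → ℝ) : Set (EuclideanSpace ℝ (Fin d)) := {x | ∀ a, l a ≤ x a ∧ x a ≤ u a}

theorem box_eq_preimage (l u : Fin d → ℝ) :
    box l u = (MeasurableEquiv.toLp 2 (Fin d → ℝ)).symm ⁻¹' Set.Icc l u := by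
  ext x
  simp [box, Set.mem_Icc, Pi.le_def, forall_and]

theorem volume_box (l u : Fin d → ℝ) : volume (box l u) = ∏ a, ENNReal.ofReal (u a - l a) := by
  rw [box_eq_preimage, (EuclideanSpace.volume_preserving_symm_measurableEquiv_toLp
    (Fin d)).measure_preimage_equiv, Real.volume_Icc_pi]

theorem isClosed_box (l u : Fin d → ℝ) : IsClosed (box l u) := by
  simp only [box, Set.ofPred_forall, Set.ofPred_and]
  refine isClosed_iInter fun a => ?_
  have : Continuous fun x : EuclideanSpace ℝ (Fin d) => x a := by fun_prop
  exact (isClosed_le continuous_const this).inter (isClosed_le this continuous_const)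

theorem cube_eq_box {k : ℕ} (i : MultiIndex b d k) :
    cube i = box (corner i) (fun a => corner i a + sideLength b k) := rfl

theorem isClosed_cube {k : ℕ} (i : MultiIndex b d k) : IsClosed (cube i) := isClosed_box _ _

theorem volume_cube {k : ℕ} (i : MultiIndex b d k) :
    volume (cube i) = ENNReal.ofReal (sideLength b k) ^ d := by
  simp [cube_eq_box, volume_box]

/-- Some coordinates of the corners are different integer multiples of the side length, so the
intersection lies in a box that is degenerate in that direction. -/
theorem aedisjoint_cube (hb : ∀ k, 0 < b (k + 1)) {k : ℕ} {i j : MultiIndex b d k} (hij : i ≠ j) :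
    AEDisjoint volume (cube i) (cube j) := by
  obtain ⟨a, ha⟩ : ∃ a, cornerNum i a ≠ cornerNum j a :=
    Function.ne_iff.1 (cornerNum_injective.ne hij)
  have hM : (0 : ℝ) < bigM b k := by exact_mod_cast bigM_pos hb k
  have hsub : cube i ∩ cube j ⊆ box (fun a => max (corner i a) (corner j a))
      (fun a => min (corner i a + sideLength b k) (corner j a + sideLength b k)) :=
    fun x hx c => ⟨max_le (hx.1 c).1 (hx.2 c).1, le_min (hx.1 c).2 (hx.2 c).2⟩
  refine measure_mono_null hsub ?_
  rw [volume_box]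
  refine Finset.prod_eq_zero (Finset.mem_univ a) (ENNReal.ofReal_eq_zero.2 ?_)
  rw [sub_nonpos, corner_eq_cornerNum_div hb, corner_eq_cornerNum_div hb]
  unfold sideLength
  rcases lt_or_gt_of_ne ha with h | h
  · refine (min_le_left _ _).trans (le_trans ?_ (le_max_right _ _))
    rw [← add_div]
    gcongr
    exact_mod_cast h
  · refine (min_le_right _ _).trans (le_trans ?_ (le_max_left _ _))
    rw [← add_div]
    gcongr
    exact_mod_cast h

theorem dist_le_of_mem_cube {k : ℕ} {i : MultiIndex b d k} {x y : EuclideanSpace ℝ (Fin d)}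
    (hx : x ∈ cube i) (hy : y ∈ cube i) : dist x y ≤ d * sideLength b k := by
  have hs : 0 ≤ sideLength b k := by unfold sideLength; positivity
  rw [EuclideanSpace.dist_eq]
  apply Real.sqrt_le_iff.2 ⟨by positivity, ?_⟩
  calc ∑ a, dist (x a) (y a) ^ 2 ≤ ∑ _a : Fin d, sideLength b k ^ 2 := by
        refine Finset.sum_le_sum fun a _ => ?_
        have := hx a
        have := hy a
        refine pow_le_pow_left₀ dist_nonneg ?_ 2
        rw [Real.dist_eq, abs_le]
        constructor <;> linarith
    _ = d * sideLength b k ^ 2 := by simp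
    _ ≤ (d * sideLength b k) ^ 2 := by
        rw [mul_pow]
        gcongr
        exact_mod_cast Nat.le_self_pow two_ne_zero d

/-- In units of the side length, each coordinate of the corner lies in a fixed interval of length
`3`, which contains at most four integers. -/
theorem card_cube_inter_ball_le (hb : ∀ k, 0 < b (k + 1)) {k : ℕ} {x : EuclideanSpace ℝ (Fin d)}
    {r : ℝ} (hr : r ≤ sideLength b k) {S : Finset (MultiIndex b d k)}
    (hS : ∀ i ∈ S, (cube i ∩ Metric.ball x r).Nonempty) : S.card ≤ 4 ^ d := by
  have hM : (0 : ℝ) < bigM b k := by exact_mod_cast bigM_pos hb k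
  let T : Finset (Fin d → ℤ) := Fintype.piFinset fun a =>
    Finset.Icc ⌈x a * bigM b k - 2⌉ ⌊x a * bigM b k + 1⌋
  have hT : T.card ≤ 4 ^ d := by
    rw [Fintype.card_piFinset]
    calc _ ≤ ∏ _a : Fin d, 4 := by
          refine Finset.prod_le_prod' fun a _ => ?_
          rw [Int.card_Icc]
          have h1 := Int.floor_le (x a * bigM b k + 1)
          have h2 := Int.le_ceil (x a * bigM b k - 2)
          have : ⌊x a * bigM b k + 1⌋ ≤ ⌈x a * bigM b k - 2⌉ + 3 := by
            have : (⌊x a * bigM b k + 1⌋ : ℝ) ≤ ⌈x a * bigM b k - 2⌉ + 3 := by linarith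
            exact_mod_cast this
          omega
      _ = 4 ^ d := by simp
  refine le_trans (Finset.card_le_card_of_injOn (fun i a => (cornerNum i a : ℤ)) ?_ ?_) hT
  · intro i hi
    obtain ⟨y, hy, hyr⟩ := hS i hi
    simp only [T, Finset.mem_coe, Fintype.mem_piFinset, Finset.mem_Icc]
    intro a
    have h1 : |y a - x a| < r := by
      have h3 : ‖(y - x) a‖ ≤ ‖y - x‖ := PiLp.norm_apply_le (y - x) a
      rw [← dist_eq_norm] at h3
      exact h3.trans_lt (Metric.mem_ball.1 hyr)
    rw [abs_lt] at h1
    have h2 := hy a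
    rw [corner_eq_cornerNum_div hb] at h2
    unfold sideLength at h2 hr
    rw [← add_div, div_le_iff₀ hM, le_div_iff₀ hM] at h2
    rw [le_div_iff₀ hM] at hr
    rw [Int.ceil_le, Int.le_floor]
    push_cast
    constructor <;> nlinarith
  · intro i _ j _ h
    apply cornerNum_injective
    funext a
    exact Int.ofNat.inj (congrFun h a)

end Digits
-- Counting descendants under control of the offspring numbers.
section Counting

variable {b : ℕ → ℕ} {d : ℕ}

open Classical in
/-- The selected multi-indices of length `k`. -/
noncomputable def selected (ω : Sample b d) (k : ℕ) : Finset (MultiIndex b d k) :=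
  Finset.univ.filter (Selected ω)

/-- The selected multi-indices of length `l` that extend `i`. -/
noncomputable def descendants (ω : Sample b d) {k l : ℕ} (h : k ≤ l) (i : MultiIndex b d k) :
    Finset (MultiIndex b d l) :=
  (selected ω l).filter fun j => MultiIndex.trunc h j = i

/-- The number of extensions of `i` by one digit that are retained by the binary string `y`. -/
def childCount {k : ℕ} (y : MultiIndex b d (k + 1) → Bool) (i : MultiIndex b d k) : ℕ :=
  ((Finset.univ.filter fun j : MultiIndex b d (k + 1) =>
    MultiIndex.trunc (Nat.le_succ k) j = i).filter fun j => y j = true).card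

/-- The multiplicative tolerances: after generation `k` the offspring numbers may deviate from
their means by the factors `tol k / tol (k + 1)`, whose product telescopes. -/
noncomputable def tol (k : ℕ) : ℝ := (k + 1) / (k + 2)

/-- From generation `k₀` on, all offspring numbers are close to `m k`. -/
def Controlled (m : ℕ → ℝ) (k₀ : ℕ) (ω : Sample b d) : Prop :=
  ∀ k, k₀ ≤ k → ∀ i : MultiIndex b d k,
    m k * (tol k / tol (k + 1)) ≤ childCount (ω k) i ∧
      childCount (ω k) i ≤ m k * (tol (k + 1) / tol k)

theorem mem_selected {ω : Sample b d} {k : ℕ} {i : MultiIndex b d k} :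
    i ∈ selected ω k ↔ Selected ω i := by simp [selected]

theorem mem_descendants {ω : Sample b d} {k l : ℕ} {h : k ≤ l} {i : MultiIndex b d k}
    {j : MultiIndex b d l} :
    j ∈ descendants ω h i ↔ Selected ω j ∧ MultiIndex.trunc h j = i := by
  simp [descendants, mem_selected]

theorem selected_succ_iff {ω : Sample b d} {k : ℕ} {j : MultiIndex b d (k + 1)} :
    Selected ω j ↔ Selected ω (MultiIndex.trunc (Nat.le_succ k) j) ∧ ω k j = true := by
  constructor
  · exact fun h => ⟨fun m hm => h m (by omega), h k (by omega)⟩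
  · rintro ⟨h1, h2⟩ m hm
    rcases Nat.lt_succ_iff_lt_or_eq.1 hm with h | rfl
    · exact h1 m h
    · exact h2

theorem Selected.trunc {ω : Sample b d} {k l : ℕ} (h : k ≤ l) {j : MultiIndex b d l}
    (hj : Selected ω j) : Selected ω (MultiIndex.trunc h j) := fun m hm => hj m (by omega)

theorem prefractal_eq (ω : Sample b d) (k : ℕ) : prefractal ω k = ⋃ i ∈ selected ω k, cube i := by
  simp only [prefractal, mem_selected]

theorem prefractal_antitone (hb : ∀ k, 0 < b (k + 1)) (ω : Sample b d) :
    Antitone (prefractal ω) := by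
  intro k l h x hx
  simp only [prefractal, mem_iUnion] at hx ⊢
  obtain ⟨j, hj, hxj⟩ := hx
  exact ⟨MultiIndex.trunc h j, hj.trunc h, cube_subset_cube_trunc hb h j hxj⟩

theorem isClosed_prefractal (ω : Sample b d) (k : ℕ) : IsClosed (prefractal ω k) := by
  rw [prefractal_eq]
  exact isClosed_biUnion_finset fun i _ => isClosed_cube i

theorem isClosed_cantorSet (ω : Sample b d) : IsClosed (cantorSet ω) :=
  isClosed_iInter fun k => isClosed_prefractal ω k

theorem selected_zero (ω : Sample b d) : selected ω 0 = Finset.univ := by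
  exact Finset.eq_univ_of_forall fun i => mem_selected.2 fun m hm => absurd hm (Nat.not_lt_zero m)

theorem prefractal_zero (ω : Sample b d) : prefractal ω 0 = unitCube d := by
  simp only [prefractal_eq, selected_zero, cube_zero, Finset.mem_univ, iUnion_true]
  exact iUnion_const _

theorem cantorSet_subset_unitCube (ω : Sample b d) : cantorSet ω ⊆ unitCube d :=
  (iInter_subset _ 0).trans (prefractal_zero ω).subset

theorem isClosed_unitCube : IsClosed (unitCube d) := isClosed_box (fun _ => 0) (fun _ => 1)

theorem isCompact_unitCube : IsCompact (unitCube d) := by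
  refine Metric.isCompact_of_isClosed_isBounded isClosed_unitCube ?_
  rw [← cube_zero (b := fun _ => 1) (fun m => m.elim0), Metric.isBounded_iff]
  exact ⟨_, fun x hx y hy => dist_le_of_mem_cube hx hy⟩

theorem cube_nonempty {k : ℕ} (i : MultiIndex b d k) : (cube i).Nonempty := by
  refine ⟨WithLp.toLp 2 (corner i), fun a => ⟨le_rfl, ?_⟩⟩
  have : 0 ≤ sideLength b k := by unfold sideLength; positivity
  simpa using this

/-- Nested nonempty compact sets intersect. Survival thus becomes a condition on finitely many
entries of `ω` for each `k`, which also gives its measurability. -/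
theorem cantorSet_nonempty_iff (hb : ∀ k, 0 < b (k + 1)) {ω : Sample b d} :
    (cantorSet ω).Nonempty ↔ ∀ k, (selected ω k).Nonempty := by
  constructor
  · rintro ⟨x, hx⟩ k
    have := mem_iInter.1 hx k
    rw [prefractal_eq] at this
    simp only [mem_iUnion] at this
    obtain ⟨i, hi, -⟩ := this
    exact ⟨i, hi⟩
  · intro h
    refine IsCompact.nonempty_iInter_of_sequence_nonempty_isCompact_isClosed _
      (fun k => prefractal_antitone hb ω (Nat.le_succ k)) (fun k => ?_) ?_
      (fun k => isClosed_prefractal ω k)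
    · obtain ⟨i, hi⟩ := h k
      rw [prefractal_eq]
      exact (cube_nonempty i).mono (subset_biUnion_of_mem (u := fun i => cube i) hi)
    · rw [prefractal_zero]; exact isCompact_unitCube

theorem descendants_self {ω : Sample b d} {k : ℕ} {i : MultiIndex b d k} (hi : i ∈ selected ω k) :
    descendants ω le_rfl i = {i} := by
  ext j
  rw [mem_descendants, trunc_self, Finset.mem_singleton]
  exact ⟨fun h => h.2, fun h => ⟨h ▸ mem_selected.1 hi, h⟩⟩

theorem descendants_eq_empty {ω : Sample b d} {k l : ℕ} (h : k ≤ l) {i : MultiIndex b d k}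
    (hi : i ∉ selected ω k) : descendants ω h i = ∅ := by
  refine Finset.eq_empty_of_forall_notMem fun j hj => hi ?_
  obtain ⟨h1, rfl⟩ := mem_descendants.1 hj
  exact mem_selected.2 (h1.trunc h)

theorem card_descendants_succ (ω : Sample b d) {k l : ℕ} (h : k ≤ l) (i : MultiIndex b d k) :
    (descendants ω (h.trans (Nat.le_succ l)) i).card =
      ∑ j ∈ descendants ω h i, childCount (ω l) j := by
  rw [Finset.card_eq_sum_card_fiberwise (f := MultiIndex.trunc (Nat.le_succ l))
    (t := descendants ω h i)]
  · refine Finset.sum_congr rfl fun j hj => ?_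
    congr 1
    ext j'
    simp only [Finset.mem_filter, mem_descendants, Finset.mem_univ, true_and] at hj ⊢
    constructor
    · rintro ⟨⟨h1, h2⟩, h3⟩
      exact ⟨h3, (selected_succ_iff.1 h1).2⟩
    · rintro ⟨rfl, h2⟩
      exact ⟨⟨selected_succ_iff.2 ⟨hj.1, h2⟩, hj.2⟩, rfl⟩
  · intro j hj
    simp only [Finset.mem_coe, mem_descendants] at hj ⊢
    exact ⟨hj.1.trunc _, hj.2⟩

theorem card_selected_eq_sum (ω : Sample b d) {k l : ℕ} (h : k ≤ l) :
    (selected ω l).card = ∑ i ∈ selected ω k, (descendants ω h i).card := by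
  rw [Finset.card_eq_sum_card_fiberwise (f := MultiIndex.trunc h) (t := selected ω k)]
  · rfl
  · intro j hj
    simp only [Finset.mem_coe, mem_selected] at hj ⊢
    exact hj.trunc h

theorem tol_pos (k : ℕ) : 0 < tol k := by unfold tol; positivity

theorem tol_lt_one (k : ℕ) : tol k < 1 := by
  unfold tol
  rw [div_lt_one (by positivity)]
  linarith

theorem half_le_tol (k : ℕ) : 1 / 2 ≤ tol k := by
  unfold tol
  rw [div_le_div_iff₀ (by norm_num) (by positivity)]
  have : (0 : ℝ) ≤ k := by positivity
  linarith

theorem tendsto_tol : Tendsto tol atTop (𝓝 1) := by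
  have h : tol = fun k : ℕ => 1 - 1 / ((k : ℝ) + 1 + 1) := by
    funext k; unfold tol; field_simp; ring
  rw [h]
  have := (tendsto_one_div_add_atTop_nhds_zero_nat (𝕜 := ℝ)).comp (tendsto_add_atTop_nat 1)
  simpa [Function.comp_def] using this.const_sub 1

/-- This is the relative deviation that the Chernoff bound must control: summable in `k`, yet only
polynomially small. -/
theorem tol_ratio (k : ℕ) : tol k / tol (k + 1) = 1 - 1 / ((k : ℝ) + 2) ^ 2 := by
  unfold tol
  push_cast
  field_simp
  ring

variable {m : ℕ → ℝ} {k₀ : ℕ} {ω : Sample b d}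

theorem Controlled.card_descendants_bounds (hm : ∀ k, 0 < m k) (hω : Controlled m k₀ ω)
    {k l : ℕ} (hk : k₀ ≤ k) (h : k ≤ l) {i : MultiIndex b d k} (hi : i ∈ selected ω k) :
    (∏ j ∈ Finset.Ico k l, m j) * (tol k / tol l) ≤ (descendants ω h i).card ∧
      (descendants ω h i).card ≤ (∏ j ∈ Finset.Ico k l, m j) * (tol l / tol k) := by
  induction l, h using Nat.le_induction with
  | base =>
    have := (tol_pos k).ne'
    simp [descendants_self hi, this]
  | succ l h ih =>
    have h0 := tol_pos k
    have h1 := tol_pos l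
    have h2 := tol_pos (l + 1)
    have hml := hm l
    rw [card_descendants_succ ω h i, Finset.prod_Ico_succ_top h]
    push_cast
    have hc := hω l (hk.trans h)
    constructor
    · calc _ = (∏ j ∈ Finset.Ico k l, m j) * (tol k / tol l) * (m l * (tol l / tol (l + 1))) := by
            field_simp
        _ ≤ (descendants ω h i).card * (m l * (tol l / tol (l + 1))) := by
            gcongr
            exact ih.1
        _ = ∑ _j ∈ descendants ω h i, (m l * (tol l / tol (l + 1))) := by simp
        _ ≤ _ := Finset.sum_le_sum fun j _ => (hc j).1
    · calc _ ≤ ∑ _j ∈ descendants ω h i, (m l * (tol (l + 1) / tol l)) :=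
            Finset.sum_le_sum fun j _ => (hc j).2
        _ = (descendants ω h i).card * (m l * (tol (l + 1) / tol l)) := by simp
        _ ≤ (∏ j ∈ Finset.Ico k l, m j) * (tol l / tol k) * (m l * (tol (l + 1) / tol l)) := by
            gcongr
            exact ih.2
        _ = _ := by field_simp

/-- With the next lemma this is equidistribution: each selected cube has nearly its fair share of
descendants. The error is at most `(tol l / tol k) ^ 2`, and `tol l < 1` makes it independent of
`l`. -/
theorem Controlled.card_descendants_le_mul (hm : ∀ k, 0 < m k) (hω : Controlled m k₀ ω)
    {k l : ℕ} (hk : k₀ ≤ k) (h : k ≤ l) (i : MultiIndex b d k) :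
    ((descendants ω h i).card : ℝ) * (selected ω k).card * tol k ^ 2 ≤ (selected ω l).card := by
  by_cases hi : i ∈ selected ω k
  swap
  · simp [descendants_eq_empty h hi]
  have hP : 0 < ∏ j ∈ Finset.Ico k l, m j := Finset.prod_pos fun j _ => hm j
  have h0 := tol_pos k
  have h1 := tol_pos l
  have h2 := tol_lt_one l
  rw [card_selected_eq_sum ω h]
  push_cast
  calc _ ≤ (∏ j ∈ Finset.Ico k l, m j) * (tol l / tol k) * (selected ω k).card * tol k ^ 2 := by
        gcongr
        exact (hω.card_descendants_bounds hm hk h hi).2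
    _ = (selected ω k).card * ((∏ j ∈ Finset.Ico k l, m j) * (tol k * tol l)) := by
        field_simp
    _ ≤ (selected ω k).card * ((∏ j ∈ Finset.Ico k l, m j) * (tol k / tol l)) := by
        gcongr
        rw [le_div_iff₀ h1]
        nlinarith [mul_pos h0 h1]
    _ = ∑ _i' ∈ selected ω k, ((∏ j ∈ Finset.Ico k l, m j) * (tol k / tol l)) := by simp
    _ ≤ _ := Finset.sum_le_sum fun j hj => (hω.card_descendants_bounds hm hk h hj).1

theorem Controlled.mul_le_card_descendants (hm : ∀ k, 0 < m k) (hω : Controlled m k₀ ω)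
    {k l : ℕ} (hk : k₀ ≤ k) (h : k ≤ l) {i : MultiIndex b d k} (hi : i ∈ selected ω k) :
    ((selected ω l).card : ℝ) * tol k ^ 2 ≤ (descendants ω h i).card * (selected ω k).card := by
  have hP : 0 < ∏ j ∈ Finset.Ico k l, m j := Finset.prod_pos fun j _ => hm j
  have h0 := tol_pos k
  have h1 := tol_pos l
  have h2 := tol_lt_one l
  rw [card_selected_eq_sum ω h]
  push_cast
  calc _ ≤ (∑ _i' ∈ selected ω k, ((∏ j ∈ Finset.Ico k l, m j) * (tol l / tol k))) * tol k ^ 2 := by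
        gcongr with j hj
        exact (hω.card_descendants_bounds hm hk h hj).2
    _ = ((∏ j ∈ Finset.Ico k l, m j) * (tol k * tol l)) * (selected ω k).card := by
        simp only [Finset.sum_const, nsmul_eq_mul]
        field_simp
    _ ≤ ((∏ j ∈ Finset.Ico k l, m j) * (tol k / tol l)) * (selected ω k).card := by
        gcongr
        rw [le_div_iff₀ h1]
        nlinarith [mul_pos h0 h1]
    _ ≤ _ := by
        gcongr
        exact (hω.card_descendants_bounds hm hk h hi).1

/-- The number of selected cubes of generation `k` is comparable with its mean. -/
theorem Controlled.exists_card_selected_bounds (hm : ∀ k, 0 < m k) (hω : Controlled m k₀ ω)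
    (hne : (selected ω k₀).Nonempty) :
    ∃ C : ℝ, 0 < C ∧ ∀ k, k₀ ≤ k →
      C⁻¹ * ∏ j ∈ Finset.range k, m j ≤ (selected ω k).card ∧
        (selected ω k).card ≤ C * ∏ j ∈ Finset.range k, m j := by
  have hP0 : 0 < ∏ j ∈ Finset.range k₀, m j := Finset.prod_pos fun j _ => hm j
  have hZ : (1 : ℝ) ≤ (selected ω k₀).card := by exact_mod_cast hne.card_pos
  set P := ∏ j ∈ Finset.range k₀, m j with hPdef
  -- The first `k₀` generations are uncontrolled. The first summand serves the lower bound, with at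
  -- least one selected cube at generation `k₀`, and the second one the upper bound; each `2` bounds
  -- a ratio of tolerances.
  refine ⟨2 * P + 2 * (selected ω k₀).card / P, by positivity, fun k hk => ?_⟩
  have hsplit : ∏ j ∈ Finset.range k, m j = P * ∏ j ∈ Finset.Ico k₀ k, m j :=
    (Finset.prod_range_mul_prod_Ico m hk).symm
  have hQ : 0 < ∏ j ∈ Finset.Ico k₀ k, m j := Finset.prod_pos fun j _ => hm j
  set Q := ∏ j ∈ Finset.Ico k₀ k, m j
  rw [hsplit, card_selected_eq_sum ω hk]
  push_cast
  have h0 := half_le_tol k₀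
  have h1 := half_le_tol k
  have h2 := tol_lt_one k₀
  have h3 := tol_lt_one k
  have hlow : 1 / 2 ≤ tol k₀ / tol k := by
    rw [le_div_iff₀ (by linarith)]; linarith
  have hup : tol k / tol k₀ ≤ 2 := by
    rw [div_le_iff₀ (by linarith)]; linarith
  constructor
  · calc _ ≤ (2 * P)⁻¹ * (P * Q) := by
          gcongr
          have : 0 ≤ 2 * ((selected ω k₀).card : ℝ) / P := by positivity
          linarith
      _ = 1 * (Q * (1 / 2)) := by field_simp
      _ ≤ (selected ω k₀).card * (Q * (tol k₀ / tol k)) := by gcongr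
      _ = ∑ _i ∈ selected ω k₀, Q * (tol k₀ / tol k) := by simp
      _ ≤ _ := Finset.sum_le_sum fun j hj => (hω.card_descendants_bounds hm le_rfl hk hj).1
  · calc _ ≤ ∑ _i ∈ selected ω k₀, Q * (tol k / tol k₀) :=
          Finset.sum_le_sum fun j hj => (hω.card_descendants_bounds hm le_rfl hk hj).2
      _ = (selected ω k₀).card * (Q * (tol k / tol k₀)) := by simp
      _ ≤ (selected ω k₀).card * (Q * 2) := by gcongr
      _ = (2 * (selected ω k₀).card / P) * (P * Q) := by field_simp
      _ ≤ _ := by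
          gcongr
          linarith

theorem Controlled.selected_nonempty (hm : ∀ k, 0 < m k) (hω : Controlled m k₀ ω)
    (hne : (selected ω k₀).Nonempty) (k : ℕ) : (selected ω k).Nonempty := by
  rcases le_total k k₀ with h | h
  · obtain ⟨i, hi⟩ := hne
    exact ⟨MultiIndex.trunc h i, mem_selected.2 ((mem_selected.1 hi).trunc h)⟩
  · obtain ⟨C, hC, hk⟩ := hω.exists_card_selected_bounds hm hne
    have hP : 0 < ∏ j ∈ Finset.range k, m j := Finset.prod_pos fun j _ => hm j
    have : (0 : ℝ) < (selected ω k).card := lt_of_lt_of_le (by positivity) (hk k h).1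
    exact Finset.card_pos.1 (by exact_mod_cast this)

end Counting
-- Existence of the limit measure and its mass on cubes and balls.
section WeakLimit

variable {b : ℕ → ℕ} {d : ℕ}

theorem restrict_prefractal (hb : ∀ k, 0 < b (k + 1)) (ω : Sample b d) (l : ℕ) :
    (volume : Measure (EuclideanSpace ℝ (Fin d))).restrict (prefractal ω l) =
      ∑ j ∈ selected ω l, volume.restrict (cube j) := by
  have h : prefractal ω l = ⋃ j : selected ω l, cube (j : MultiIndex b d l) := by
    ext x
    simp [prefractal_eq]
  rw [h, Measure.restrict_iUnion_ae, Measure.sum_fintype,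
    Finset.sum_coe_sort (selected ω l)
      (fun j => (volume : Measure (EuclideanSpace ℝ (Fin d))).restrict (cube j))]
  · intro i j hij
    exact aedisjoint_cube hb (Subtype.coe_ne_coe.2 hij)
  · exact fun j => (isClosed_cube _).measurableSet.nullMeasurableSet

theorem volume_prefractal (hb : ∀ k, 0 < b (k + 1)) (ω : Sample b d) (l : ℕ) :
    volume (prefractal ω l) = (selected ω l).card * ENNReal.ofReal (sideLength b l) ^ d := by
  rw [← Measure.restrict_apply_univ, restrict_prefractal hb]
  simp [volume_cube]

theorem volume_prefractal_ne_zero (hb : ∀ k, 0 < b (k + 1)) {ω : Sample b d} {l : ℕ}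
    (hne : (selected ω l).Nonempty) : volume (prefractal ω l) ≠ 0 := by
  rw [volume_prefractal hb]
  have := sideLength_pos hb l
  simp [hne.ne_empty, this]

theorem volume_prefractal_ne_top (hb : ∀ k, 0 < b (k + 1)) (ω : Sample b d) (l : ℕ) :
    volume (prefractal ω l) ≠ ∞ := by
  rw [volume_prefractal hb]
  exact ENNReal.mul_ne_top (by simp) (by simp)

theorem isProbabilityMeasure_prefractalMeasure (hb : ∀ k, 0 < b (k + 1)) {ω : Sample b d} {l : ℕ}
    (hne : (selected ω l).Nonempty) : IsProbabilityMeasure (prefractalMeasure ω l) :=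
  cond_isProbabilityMeasure_of_finite (volume_prefractal_ne_zero hb hne)
    (volume_prefractal_ne_top hb ω l)

/-- The measure `μ_l`, as a probability measure. -/
noncomputable def prefractalProb (hb : ∀ k, 0 < b (k + 1)) {ω : Sample b d} {l : ℕ}
    (hne : (selected ω l).Nonempty) : ProbabilityMeasure (EuclideanSpace ℝ (Fin d)) :=
  ⟨prefractalMeasure ω l, isProbabilityMeasure_prefractalMeasure hb hne⟩

theorem prefractalMeasure_compl_eq_zero (hb : ∀ k, 0 < b (k + 1)) (ω : Sample b d) {k l : ℕ}
    (h : k ≤ l) : prefractalMeasure ω l (prefractal ω k)ᶜ = 0 := by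
  unfold prefractalMeasure
  rw [cond_apply (isClosed_prefractal ω l).measurableSet]
  have : prefractal ω l ∩ (prefractal ω k)ᶜ = ∅ := by
    rw [← Set.sdiff_eq, Set.sdiff_eq_empty]
    exact prefractal_antitone hb ω h
  simp [this]

theorem integral_prefractalMeasure (hb : ∀ k, 0 < b (k + 1)) (ω : Sample b d) (l : ℕ)
    (f : EuclideanSpace ℝ (Fin d) →ᵇ ℝ) :
    ∫ x, f x ∂(prefractalMeasure ω l) =
      ∑ j ∈ selected ω l, ((selected ω l).card : ℝ)⁻¹ *
        ((sideLength b l ^ d)⁻¹ * ∫ x in cube j, f x) := by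
  have hs := sideLength_pos hb l
  unfold prefractalMeasure ProbabilityTheory.cond
  rw [integral_smul_measure, restrict_prefractal hb, integral_finsetSum_measure]
  · rw [volume_prefractal hb, smul_eq_mul, Finset.mul_sum]
    refine Finset.sum_congr rfl fun j _ => ?_
    rw [ENNReal.toReal_inv, ENNReal.toReal_mul, ENNReal.toReal_pow,
      ENNReal.toReal_ofReal hs.le, ENNReal.toReal_natCast, mul_inv, mul_assoc]
  · intro j _
    have : IsFiniteMeasure ((volume : Measure (EuclideanSpace ℝ (Fin d))).restrict (cube j)) :=
      ⟨by simp [volume_cube]⟩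
    exact f.integrable _

theorem abs_average_cube_sub_le (hb : ∀ k, 0 < b (k + 1)) {l : ℕ} (j : MultiIndex b d l)
    (f : EuclideanSpace ℝ (Fin d) →ᵇ ℝ) {c η : ℝ} (h : ∀ x ∈ cube j, |f x - c| ≤ η) :
    |(sideLength b l ^ d)⁻¹ * (∫ x in cube j, f x) - c| ≤ η := by
  have hs : 0 < sideLength b l ^ d := pow_pos (sideLength_pos hb l) d
  have hfin : IsFiniteMeasure
      ((volume : Measure (EuclideanSpace ℝ (Fin d))).restrict (cube j)) :=
    ⟨by simp [volume_cube]⟩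
  have hvol : (volume : Measure (EuclideanSpace ℝ (Fin d))).real (cube j) = sideLength b l ^ d := by
    rw [Measure.real, volume_cube, ENNReal.toReal_pow,
      ENNReal.toReal_ofReal (sideLength_pos hb l).le]
  have h1 : (∫ x in cube j, f x) - sideLength b l ^ d * c = ∫ x in cube j, (f x - c) := by
    rw [integral_sub (f.integrable _) (integrable_const _), setIntegral_const, hvol, smul_eq_mul]
  have h2 : |∫ x in cube j, (f x - c)| ≤ η * sideLength b l ^ d := by
    rw [← hvol, ← Real.norm_eq_abs]
    exact norm_setIntegral_le_of_norm_le_const (by simp [volume_cube]) h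
  calc _ = |(sideLength b l ^ d)⁻¹ * ((∫ x in cube j, f x) - sideLength b l ^ d * c)| := by
        congr 1; field_simp
    _ = (sideLength b l ^ d)⁻¹ * |∫ x in cube j, (f x - c)| := by
        rw [abs_mul, h1, abs_of_pos (inv_pos.2 hs)]
    _ ≤ (sideLength b l ^ d)⁻¹ * (η * sideLength b l ^ d) := by gcongr
    _ = η := by field_simp

variable {m : ℕ → ℝ} {k₀ : ℕ} {ω : Sample b d}

/-- The Riemann sum of generation `k` does not depend on `l`. Moving each small cube to its
ancestor's corner costs the oscillation `η`, and replacing the true share of descendants by `1/Z_k`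
costs the equidistribution error. -/
theorem Controlled.abs_integral_sub_le (hb : ∀ k, 0 < b (k + 1)) (hm : ∀ k, 0 < m k)
    (hω : Controlled m k₀ ω) (hne : (selected ω k₀).Nonempty)
    (f : EuclideanSpace ℝ (Fin d) →ᵇ ℝ) {η : ℝ} {k l : ℕ} (hk : k₀ ≤ k) (h : k ≤ l)
    (hf : ∀ i : MultiIndex b d k, ∀ x ∈ cube i, ∀ y ∈ cube i, |f x - f y| ≤ η) :
    |∫ x, f x ∂(prefractalMeasure ω l) -
      ∑ i ∈ selected ω k, ((selected ω k).card : ℝ)⁻¹ * f (WithLp.toLp 2 (corner i))| ≤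
        η + ((tol k ^ 2)⁻¹ - 1) * ‖f‖ := by
  have hZl : (0 : ℝ) < (selected ω l).card := by
    exact_mod_cast (hω.selected_nonempty hm hne l).card_pos
  have hZk : (0 : ℝ) < (selected ω k).card := by
    exact_mod_cast (hω.selected_nonempty hm hne k).card_pos
  have ht := tol_pos k
  have ht1 := tol_lt_one k
  have hcorner : ∀ i : MultiIndex b d k, (WithLp.toLp 2 (corner i) : EuclideanSpace ℝ (Fin d)) ∈ cube i := by
    refine fun i a => ⟨le_rfl, ?_⟩
    simpa using (sideLength_pos hb k).le
  have hmid : ∑ j ∈ selected ω l, ((selected ω l).card : ℝ)⁻¹ *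
      f (WithLp.toLp 2 (corner (MultiIndex.trunc h j))) =
      ∑ i ∈ selected ω k, ((descendants ω h i).card : ℝ) * ((selected ω l).card : ℝ)⁻¹ *
        f (WithLp.toLp 2 (corner i)) := by
    rw [← Finset.sum_fiberwise_of_maps_to (g := MultiIndex.trunc h) (t := selected ω k)]
    · refine Finset.sum_congr rfl fun i _ => ?_
      rw [Finset.sum_congr rfl (g := fun _ => ((selected ω l).card : ℝ)⁻¹ *
        f (WithLp.toLp 2 (corner i)))]
      · rw [Finset.sum_const, nsmul_eq_mul, mul_assoc]
        rfl
      · intro j hj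
        rw [(Finset.mem_filter.1 hj).2]
    · exact fun j hj => mem_selected.2 ((mem_selected.1 hj).trunc h)
  have h1 : |∫ x, f x ∂(prefractalMeasure ω l) - ∑ j ∈ selected ω l, ((selected ω l).card : ℝ)⁻¹ *
      f (WithLp.toLp 2 (corner (MultiIndex.trunc h j)))| ≤ η := by
    rw [integral_prefractalMeasure hb, ← Finset.sum_sub_distrib]
    calc _ ≤ ∑ j ∈ selected ω l, ((selected ω l).card : ℝ)⁻¹ * η := by
          refine (Finset.abs_sum_le_sum_abs _ _).trans (Finset.sum_le_sum fun j _ => ?_)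
          rw [← mul_sub, abs_mul, abs_of_pos (inv_pos.2 hZl)]
          gcongr
          exact abs_average_cube_sub_le hb j f fun x hx =>
            hf _ x (cube_subset_cube_trunc hb h j hx) _ (hcorner _)
      _ = η := by
          rw [Finset.sum_const, nsmul_eq_mul]
          field_simp
  have h2 : |(∑ j ∈ selected ω l, ((selected ω l).card : ℝ)⁻¹ *
      f (WithLp.toLp 2 (corner (MultiIndex.trunc h j)))) -
      ∑ i ∈ selected ω k, ((selected ω k).card : ℝ)⁻¹ * f (WithLp.toLp 2 (corner i))| ≤
      ((tol k ^ 2)⁻¹ - 1) * ‖f‖ := by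
    rw [hmid, ← Finset.sum_sub_distrib]
    calc _ ≤ ∑ i ∈ selected ω k, ((selected ω k).card : ℝ)⁻¹ * (((tol k ^ 2)⁻¹ - 1) * ‖f‖) := by
          refine (Finset.abs_sum_le_sum_abs _ _).trans (Finset.sum_le_sum fun i hi => ?_)
          rw [← sub_mul, abs_mul, ← mul_assoc]
          have hfi : |f (WithLp.toLp 2 (corner i))| ≤ ‖f‖ := f.norm_coe_le_norm _
          refine mul_le_mul ?_ hfi (abs_nonneg _) ?_
          swap
          · refine mul_nonneg (inv_nonneg.2 hZk.le) (sub_nonneg.2 ((one_le_inv₀ (by positivity)).2 ?_))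
            exact pow_le_one₀ ht.le ht1.le
          have e1 := hω.card_descendants_le_mul hm hk h i
          have e2 := hω.mul_le_card_descendants hm hk h hi
          have e3 : ((descendants ω h i).card : ℝ) * ((selected ω l).card : ℝ)⁻¹ -
              ((selected ω k).card : ℝ)⁻¹ = ((selected ω k).card : ℝ)⁻¹ *
              (((descendants ω h i).card : ℝ) * (selected ω k).card / (selected ω l).card - 1) := by
            field_simp
          rw [e3, abs_mul, abs_of_pos (inv_pos.2 hZk)]
          gcongr
          have e4 : ((descendants ω h i).card : ℝ) * (selected ω k).card / (selected ω l).card ≤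
              (tol k ^ 2)⁻¹ := by
            rw [div_le_iff₀ hZl, inv_mul_eq_div, le_div_iff₀ (by positivity)]
            exact e1
          have e5 : tol k ^ 2 ≤
              ((descendants ω h i).card : ℝ) * (selected ω k).card / (selected ω l).card := by
            rw [le_div_iff₀ hZl, mul_comm]
            exact e2
          -- This makes the lower deviation `1 - tol k ^ 2` no larger than the upper one, so one
          -- bound serves both signs.
          have e6 : 2 ≤ tol k ^ 2 + (tol k ^ 2)⁻¹ := by
            have h0 : 0 < tol k ^ 2 := by positivity
            rw [← sub_nonneg]
            have : tol k ^ 2 + (tol k ^ 2)⁻¹ - 2 = (tol k ^ 2 - 1) ^ 2 / tol k ^ 2 := by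
              field_simp; ring
            rw [this]; positivity
          rw [abs_le]
          constructor <;> linarith
      _ = _ := by
          rw [Finset.sum_const, nsmul_eq_mul]
          field_simp
  calc _ ≤ _ := abs_sub_le _ _ _
    _ ≤ _ := add_le_add h1 h2

theorem Controlled.cauchySeq_integral (hb : ∀ k, 0 < b (k + 1)) (hm : ∀ k, 0 < m k)
    (hs : Tendsto (sideLength b) atTop (𝓝 0))
    (hω : Controlled m k₀ ω) (hne : (selected ω k₀).Nonempty)
    (f : EuclideanSpace ℝ (Fin d) →ᵇ ℝ) :
    CauchySeq fun l => ∫ x, f x ∂(prefractalMeasure ω l) := by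
  rw [Metric.cauchySeq_iff']
  intro ε hε
  have hu := (isCompact_unitCube (d := d)).uniformContinuousOn_of_continuous
    f.continuous.continuousOn
  rw [Metric.uniformContinuousOn_iff] at hu
  obtain ⟨δ, hδ, hu⟩ := hu (ε / 8) (by positivity)
  have h1 : ∀ᶠ k in atTop, (d : ℝ) * sideLength b k < δ := by
    have := hs.const_mul (d : ℝ)
    rw [mul_zero] at this
    exact this.eventually_lt_const hδ
  have h2 : ∀ᶠ k in atTop, ((tol k ^ 2)⁻¹ - 1) * ‖f‖ < ε / 8 := by
    have : Tendsto (fun k => ((tol k ^ 2)⁻¹ - 1) * ‖f‖) atTop (𝓝 (((1 ^ 2)⁻¹ - 1) * ‖f‖)) :=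
      (((tendsto_tol.pow 2).inv₀ (by norm_num)).sub_const 1).mul_const _
    refine this.eventually_lt_const ?_
    simp only [one_pow, inv_one, sub_self, zero_mul]
    positivity
  obtain ⟨k, ⟨hk1, hk2⟩, hk⟩ := ((h1.and h2).and (eventually_ge_atTop k₀)).exists
  have hf : ∀ i : MultiIndex b d k, ∀ x ∈ cube i, ∀ y ∈ cube i, |f x - f y| ≤ ε / 8 := by
    intro i x hx y hy
    have hsub : cube i ⊆ unitCube d := by
      rw [← cube_zero (MultiIndex.trunc (Nat.zero_le k) i)]
      exact cube_subset_cube_trunc hb _ i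
    have := hu x (hsub hx) y (hsub hy) ((dist_le_of_mem_cube hx hy).trans_lt hk1)
    rw [Real.dist_eq] at this
    exact this.le
  refine ⟨k, fun l hl => ?_⟩
  have e1 := hω.abs_integral_sub_le hb hm hne f hk hl hf
  have e2 := hω.abs_integral_sub_le hb hm hne f hk le_rfl hf
  rw [Real.dist_eq]
  rw [abs_sub_comm] at e2
  refine (abs_sub_le _ _ _).trans_lt ((add_le_add e1 e2).trans_lt ?_)
  linarith

/-- All `μ_l` live on the compact unit cube, so Prokhorov's theorem gives a cluster point; since the
integrals are Cauchy, the whole sequence converges to it. -/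
theorem Controlled.exists_isCantorMeasure (hb : ∀ k, 0 < b (k + 1)) (hm : ∀ k, 0 < m k)
    (hs : Tendsto (sideLength b) atTop (𝓝 0))
    (hω : Controlled m k₀ ω) (hne : (selected ω k₀).Nonempty) :
    ∃ μ : ProbabilityMeasure (EuclideanSpace ℝ (Fin d)), IsCantorMeasure ω μ := by
  have hne' := hω.selected_nonempty hm hne
  let P : ℕ → ProbabilityMeasure (EuclideanSpace ℝ (Fin d)) := fun l => prefractalProb hb (hne' l)
  have hcube : ∀ l, prefractalMeasure ω l (unitCube d)ᶜ = 0 := fun l => by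
    rw [← prefractal_zero ω]
    exact prefractalMeasure_compl_eq_zero hb ω (Nat.zero_le l)
  have htight : IsTightMeasureSet
      {x : Measure (EuclideanSpace ℝ (Fin d)) | ∃ μ ∈ range P, (μ : Measure _) = x} := by
    rw [isTightMeasureSet_iff_exists_isCompact_measure_compl_le]
    intro ε _
    refine ⟨unitCube d, isCompact_unitCube, ?_⟩
    rintro _ ⟨_, ⟨l, rfl⟩, rfl⟩
    exact (hcube l).le.trans zero_le
  have hcompact := isCompact_closure_of_isTightMeasureSet htight
  obtain ⟨μ, -, hμ⟩ := hcompact.exists_mapClusterPt_of_frequently (f := P) (l := atTop)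
    (Frequently.of_forall fun l => subset_closure (mem_range_self l))
  have hlim : ∀ f : EuclideanSpace ℝ (Fin d) →ᵇ ℝ,
      Tendsto (fun k => ∫ x, f x ∂(prefractalMeasure ω k)) atTop
        (𝓝 (∫ x, f x ∂(μ : Measure (EuclideanSpace ℝ (Fin d))))) := by
    intro f
    have hcont : Continuous fun ν : ProbabilityMeasure (EuclideanSpace ℝ (Fin d)) =>
        ∫ x, f x ∂(ν : Measure (EuclideanSpace ℝ (Fin d))) :=
      continuous_iff_continuousAt.2 fun ν =>
        ProbabilityMeasure.tendsto_iff_forall_integral_tendsto.1 tendsto_id f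
    have hcl : MapClusterPt (∫ x, f x ∂(μ : Measure (EuclideanSpace ℝ (Fin d)))) atTop
        (fun k => ∫ x, f x ∂(prefractalMeasure ω k)) :=
      hμ.continuousAt_comp hcont.continuousAt
    exact le_nhds_of_cauchy_adhp
      (hω.cauchySeq_integral hb hm hs hne f) hcl
  refine ⟨μ, ?_, hlim⟩
  have hP : Tendsto P atTop (𝓝 μ) :=
    ProbabilityMeasure.tendsto_iff_forall_integral_tendsto.2 hlim
  -- The complement of `E_k` is open and is null for `μ_l` once `l ≥ k`, so the portmanteau theorem
  -- makes it null for `μ`.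
  rw [cantorSet, compl_iInter, measure_iUnion_null_iff]
  intro k
  have := ProbabilityMeasure.le_liminf_measure_open_of_tendsto hP
    (isClosed_prefractal ω k).isOpen_compl
  refine le_antisymm (this.trans ?_) zero_le
  refine liminf_le_of_frequently_le' (Eventually.frequently ?_)
  filter_upwards [eventually_ge_atTop k] with l hl
  exact (prefractalMeasure_compl_eq_zero hb ω hl).le

/-- The ball meets at most `4 ^ d` cubes, so that it has small measure. -/
theorem Controlled.prefractalMeasure_ball_le (hb : ∀ k, 0 < b (k + 1)) (hm : ∀ k, 0 < m k)
    (hω : Controlled m k₀ ω) (hne : (selected ω k₀).Nonempty) {k l : ℕ} (hk : k₀ ≤ k) (h : k ≤ l)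
    (x : EuclideanSpace ℝ (Fin d)) {r : ℝ} (hr : r ≤ sideLength b k) :
    prefractalMeasure ω l (Metric.ball x r) ≤
      ENNReal.ofReal (4 ^ (d + 1) / (selected ω k).card) := by
  classical
  have hZl : (0 : ℝ) < (selected ω l).card := by
    exact_mod_cast (hω.selected_nonempty hm hne l).card_pos
  have hZk : (0 : ℝ) < (selected ω k).card := by
    exact_mod_cast (hω.selected_nonempty hm hne k).card_pos
  have hδ := sideLength_pos hb l
  have hδd : (0 : ℝ) < sideLength b l ^ d := by positivity
  let S : Finset (MultiIndex b d k) :=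
    Finset.univ.filter fun i => (cube i ∩ Metric.ball x r).Nonempty
  have hS : S.card ≤ 4 ^ d := card_cube_inter_ball_le hb hr fun i hi => (Finset.mem_filter.1 hi).2
  have hcov : prefractal ω l ∩ Metric.ball x r ⊆ ⋃ i ∈ S, ⋃ j ∈ descendants ω h i, cube j := by
    rintro y ⟨hy, hyr⟩
    rw [prefractal_eq] at hy
    simp only [mem_iUnion] at hy ⊢
    obtain ⟨j, hj, hyj⟩ := hy
    refine ⟨MultiIndex.trunc h j, ?_, j, mem_descendants.2 ⟨mem_selected.1 hj, rfl⟩, hyj⟩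
    exact Finset.mem_filter.2 ⟨Finset.mem_univ _, y, cube_subset_cube_trunc hb h j hyj, hyr⟩
  -- The factor `4` comes from `tol k ≥ 1 / 2`, which enters squared.
  have hdesc : ∀ i, ((descendants ω h i).card : ℝ) ≤
      4 * (selected ω l).card / (selected ω k).card := by
    intro i
    have h1 := hω.card_descendants_le_mul hm hk h i
    have h2 := half_le_tol k
    rw [le_div_iff₀ hZk]
    have h3 : (1 / 2 : ℝ) ^ 2 ≤ tol k ^ 2 := by gcongr
    nlinarith [mul_nonneg (Nat.cast_nonneg (α := ℝ) (descendants ω h i).card) hZk.le]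
  have hvol : volume (prefractal ω l ∩ Metric.ball x r) ≤
      ENNReal.ofReal (4 ^ d * (4 * (selected ω l).card / (selected ω k).card) *
        sideLength b l ^ d) := by
    calc _ ≤ ∑ i ∈ S, ∑ j ∈ descendants ω h i, volume (cube j) :=
          (measure_mono hcov).trans ((measure_biUnion_finset_le _ _).trans
            (Finset.sum_le_sum fun i _ => measure_biUnion_finset_le _ _))
      _ = ENNReal.ofReal (∑ i ∈ S, (descendants ω h i).card * sideLength b l ^ d) := by
          rw [ENNReal.ofReal_sum_of_nonneg fun _ _ => by positivity]
          refine Finset.sum_congr rfl fun i _ => ?_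
          simp [volume_cube, ENNReal.ofReal_mul, ENNReal.ofReal_pow hδ.le]
      _ ≤ ENNReal.ofReal (∑ i ∈ S, (4 * (selected ω l).card / (selected ω k).card) *
            sideLength b l ^ d) := by
          refine ENNReal.ofReal_le_ofReal (Finset.sum_le_sum fun i _ => ?_)
          gcongr
          exact hdesc i
      _ ≤ _ := by
          refine ENNReal.ofReal_le_ofReal ?_
          rw [Finset.sum_const, nsmul_eq_mul, ← mul_assoc]
          gcongr
          exact_mod_cast hS
  unfold prefractalMeasure
  rw [cond_apply (isClosed_prefractal ω l).measurableSet]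
  have hE : volume (prefractal ω l) =
      ENNReal.ofReal ((selected ω l).card * sideLength b l ^ d) := by
    rw [volume_prefractal hb, ENNReal.ofReal_mul (by positivity), ENNReal.ofReal_pow hδ.le]
    simp
  rw [hE, ← ENNReal.ofReal_inv_of_pos (by positivity)]
  calc _ ≤ _ := mul_le_mul_right hvol _
    _ = _ := by
      rw [← ENNReal.ofReal_mul (by positivity)]
      congr 1
      field_simp
      ring

theorem Controlled.le_prefractalMeasure (hb : ∀ k, 0 < b (k + 1)) (hm : ∀ k, 0 < m k)
    (hω : Controlled m k₀ ω) (hne : (selected ω k₀).Nonempty) {k l : ℕ} (hk : k₀ ≤ k) (h : k ≤ l)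
    {i : MultiIndex b d k} (hi : i ∈ selected ω k) :
    ENNReal.ofReal (1 / (4 * (selected ω k).card)) ≤ prefractalMeasure ω l (cube i) := by
  have hZl : (0 : ℝ) < (selected ω l).card := by
    exact_mod_cast (hω.selected_nonempty hm hne l).card_pos
  have hZk : (0 : ℝ) < (selected ω k).card := by
    exact_mod_cast (hω.selected_nonempty hm hne k).card_pos
  have hδ := sideLength_pos hb l
  have hδd : (0 : ℝ) < sideLength b l ^ d := by positivity
  have hsub : (⋃ j ∈ descendants ω h i, cube j) ⊆ prefractal ω l ∩ cube i := by
    intro y hy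
    simp only [mem_iUnion] at hy
    obtain ⟨j, hj, hyj⟩ := hy
    rw [mem_descendants] at hj
    refine ⟨?_, ?_⟩
    · rw [prefractal_eq]
      exact mem_biUnion (mem_selected.2 hj.1) hyj
    · rw [← hj.2]
      exact cube_subset_cube_trunc hb h j hyj
  have hvol : ENNReal.ofReal ((descendants ω h i).card * sideLength b l ^ d) ≤
      volume (prefractal ω l ∩ cube i) := by
    refine le_trans (le_of_eq ?_) (measure_mono hsub)
    rw [measure_biUnion_finset₀]
    · simp [volume_cube, ENNReal.ofReal_mul, ENNReal.ofReal_pow hδ.le]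
    · exact fun j _ j' _ hjj => aedisjoint_cube hb hjj
    · exact fun j _ => (isClosed_cube j).measurableSet.nullMeasurableSet
  have hdesc : (selected ω l).card / (4 * (selected ω k).card) ≤
      ((descendants ω h i).card : ℝ) := by
    have h1 := hω.mul_le_card_descendants hm hk h hi
    have h2 := half_le_tol k
    rw [div_le_iff₀ (by positivity)]
    have h3 : (1 / 2 : ℝ) ^ 2 ≤ tol k ^ 2 := by gcongr
    nlinarith
  unfold prefractalMeasure
  rw [cond_apply (isClosed_prefractal ω l).measurableSet]
  have hE : volume (prefractal ω l) =
      ENNReal.ofReal ((selected ω l).card * sideLength b l ^ d) := by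
    rw [volume_prefractal hb, ENNReal.ofReal_mul (by positivity), ENNReal.ofReal_pow hδ.le]
    simp
  rw [hE, ← ENNReal.ofReal_inv_of_pos (by positivity)]
  refine le_trans ?_ (mul_le_mul_right hvol _)
  rw [← ENNReal.ofReal_mul (by positivity)]
  refine ENNReal.ofReal_le_ofReal ?_
  calc 1 / (4 * ((selected ω k).card : ℝ)) = ((selected ω l).card * sideLength b l ^ d)⁻¹ *
        ((selected ω l).card / (4 * (selected ω k).card) * sideLength b l ^ d) := by field_simp
    _ ≤ _ := by gcongr

variable {μ : ProbabilityMeasure (EuclideanSpace ℝ (Fin d))}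

theorem tendsto_prefractalProb (hb : ∀ k, 0 < b (k + 1)) (hne : ∀ l, (selected ω l).Nonempty)
    (hμ : IsCantorMeasure ω μ) :
    Tendsto (fun l => prefractalProb hb (hne l)) atTop (𝓝 μ) :=
  ProbabilityMeasure.tendsto_iff_forall_integral_tendsto.2 hμ.2

theorem Controlled.measure_ball_le (hb : ∀ k, 0 < b (k + 1)) (hm : ∀ k, 0 < m k)
    (hω : Controlled m k₀ ω) (hne : (selected ω k₀).Nonempty) (hμ : IsCantorMeasure ω μ)
    {k : ℕ} (hk : k₀ ≤ k) (x : EuclideanSpace ℝ (Fin d)) {r : ℝ} (hr : r ≤ sideLength b k) :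
    (μ : Measure (EuclideanSpace ℝ (Fin d))).real (Metric.ball x r) ≤
      4 ^ (d + 1) / (selected ω k).card := by
  have h1 := ProbabilityMeasure.le_liminf_measure_open_of_tendsto
    (tendsto_prefractalProb hb (hω.selected_nonempty hm hne) hμ) (Metric.isOpen_ball (x := x) (ε := r))
  refine ENNReal.toReal_le_of_le_ofReal (by positivity) (h1.trans ?_)
  refine liminf_le_of_frequently_le' (Eventually.frequently ?_)
  filter_upwards [eventually_ge_atTop k] with l hl
  exact hω.prefractalMeasure_ball_le hb hm hne hk hl x hr

/-- Closed sets do not lose mass under weak limits, whereas open sets do not gain any; this is why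
lower bounds are stated for closed cubes and upper bounds for open balls. -/
theorem Controlled.le_measure_cube (hb : ∀ k, 0 < b (k + 1)) (hm : ∀ k, 0 < m k)
    (hω : Controlled m k₀ ω) (hne : (selected ω k₀).Nonempty) (hμ : IsCantorMeasure ω μ)
    {k : ℕ} (hk : k₀ ≤ k) {i : MultiIndex b d k} (hi : i ∈ selected ω k) :
    1 / (4 * (selected ω k).card) ≤
      (μ : Measure (EuclideanSpace ℝ (Fin d))).real (cube i) := by
  have h1 := ProbabilityMeasure.limsup_measure_closed_le_of_tendsto
    (tendsto_prefractalProb hb (hω.selected_nonempty hm hne) hμ) (isClosed_cube i)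
  rw [Measure.real, ← ENNReal.ofReal_le_iff_le_toReal (measure_ne_top _ _)]
  refine le_trans ?_ h1
  refine le_limsup_of_frequently_le' (Eventually.frequently ?_)
  filter_upwards [eventually_ge_atTop k] with l hl
  exact hω.le_prefractalMeasure hb hm hne hk hl hi

end WeakLimit
-- The scales `δ_k` in logarithmic form.
section Scales

variable {N : ℕ}

theorem branching_pos (hN : 2 ≤ N) (k : ℕ) : 0 < branching N (k + 1) := by
  unfold branching; positivity

/-- The `k`-th triangular number, so that `M_k = N ^ triangle k`. -/
noncomputable def triangle (k : ℕ) : ℝ := k * (k + 1) / 2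

theorem triangle_succ (k : ℕ) : triangle (k + 1) = triangle k + (k + 1) := by
  unfold triangle; push_cast; ring

theorem triangle_add (k a : ℕ) : triangle (k + a) = triangle k + a * k + triangle a := by
  unfold triangle; push_cast; ring

theorem sum_range_add_one (k : ℕ) : ∑ j ∈ Finset.range k, ((j : ℝ) + 1) = triangle k := by
  induction k with
  | zero => simp [triangle]
  | succ k ih => rw [Finset.sum_range_succ, ih, triangle_succ]

theorem triangle_nonneg (k : ℕ) : 0 ≤ triangle k := by unfold triangle; positivity

theorem le_triangle (k : ℕ) : (k : ℝ) ≤ triangle k := by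
  induction k with
  | zero => simp [triangle]
  | succ k ih =>
    rw [triangle_succ]; push_cast
    have := triangle_nonneg k
    linarith

theorem log_pos_of_two_le (hN : 2 ≤ N) : 0 < Real.log N :=
  Real.log_pos (by exact_mod_cast hN)

theorem bigM_branching (hN : 2 ≤ N) (k : ℕ) :
    (bigM (branching N) k : ℝ) = Real.exp (Real.log N * triangle k) := by
  have h0 : (0 : ℝ) < N := by positivity
  induction k with
  | zero => simp [bigM, triangle]
  | succ k ih =>
    rw [bigM_succ, Nat.cast_mul, ih, triangle_succ, mul_add, Real.exp_add]
    congr 1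
    unfold branching
    rw [Nat.cast_pow, mul_comm, ← Real.exp_log h0, Real.log_exp]
    rw [← Real.exp_nat_mul]
    push_cast
    rfl

theorem sideLength_branching (hN : 2 ≤ N) (k : ℕ) :
    sideLength (branching N) k = Real.exp (-(Real.log N * triangle k)) := by
  rw [sideLength, bigM_branching hN, Real.exp_neg, one_div]

theorem tendsto_sideLength_branching (hN : 2 ≤ N) :
    Tendsto (sideLength (branching N)) atTop (𝓝 0) := by
  have h := log_pos_of_two_le hN
  refine Tendsto.congr (fun k => (sideLength_branching hN k).symm) ?_
  refine Real.tendsto_exp_atBot.comp (tendsto_neg_atTop_atBot.comp (Tendsto.const_mul_atTop h ?_))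
  exact tendsto_atTop_mono le_triangle tendsto_natCast_atTop_atTop

/-- For `t = -log r` this places `r` between two consecutive side lengths: `δ_(k+1) ≤ r < δ_k`. -/
theorem exists_scale (hN : 2 ≤ N) {k₀ : ℕ} {t : ℝ} (ht : Real.log N * triangle k₀ < t) :
    ∃ k, k₀ ≤ k ∧ Real.log N * triangle k < t ∧ t ≤ Real.log N * triangle (k + 1) := by
  classical
  have h := log_pos_of_two_le hN
  have hex : ∃ k, t ≤ Real.log N * triangle k := by
    have : Tendsto (fun k => Real.log N * triangle k) atTop atTop :=
      Tendsto.const_mul_atTop h (tendsto_atTop_mono le_triangle tendsto_natCast_atTop_atTop)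
    exact (this.eventually_ge_atTop t).exists
  have hmono : Monotone triangle := monotone_nat_of_le_succ fun k => by
    rw [triangle_succ]; have : (0 : ℝ) ≤ k := by positivity
    linarith
  have hk₀ : k₀ < Nat.find hex := by
    by_contra hcon
    have h1 := Nat.find_spec hex
    have h2 := hmono (not_lt.1 hcon)
    nlinarith
  obtain ⟨k, hk⟩ : ∃ k, Nat.find hex = k + 1 := ⟨Nat.find hex - 1, by omega⟩
  refine ⟨k, by omega, ?_, hk ▸ Nat.find_spec hex⟩
  exact not_le.1 (Nat.find_min hex (by omega))

/-- The source of the gauge: `log (1/δ_k)` is quadratic in `k`, so a factor exponential in `k` is at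
most some `Φ_R (1 / r)`. -/
theorem mul_le_sqrt (hN : 2 ≤ N) {k : ℕ} {t : ℝ} (ht : Real.log N * triangle k ≤ t) :
    Real.log N * k ≤ √(2 * Real.log N) * √t := by
  have h := log_pos_of_two_le hN
  rw [← Real.sqrt_mul (by positivity)]
  refine Real.le_sqrt_of_sq_le ?_
  have h1 : (k : ℝ) ^ 2 ≤ 2 * triangle k := by
    unfold triangle
    have : (0 : ℝ) ≤ k := by positivity
    nlinarith
  calc (Real.log N * k) ^ 2 = Real.log N * (Real.log N * (k : ℝ) ^ 2) := by ring
    _ ≤ Real.log N * (Real.log N * (2 * triangle k)) := by gcongr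
    _ ≤ 2 * Real.log N * t := by nlinarith

end Scales

/-! ### Elementary properties of the gauge function. -/

section PhiBounds

theorem Phi_pos (R t : ℝ) : 0 < Phi R t := Real.exp_pos _

theorem one_le_Phi {R : ℝ} (hR : 0 ≤ R) (t : ℝ) : 1 ≤ Phi R t :=
  Real.one_le_exp (by positivity)

theorem Phi_mono_left {R R' : ℝ} (h : R ≤ R') (t : ℝ) : Phi R t ≤ Phi R' t :=
  Real.exp_le_exp.2 (mul_le_mul_of_nonneg_right h (Real.sqrt_nonneg _))

theorem Phi_mono_right {R : ℝ} (hR : 0 ≤ R) {s t : ℝ} (hs : 0 < s) (h : s ≤ t) :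
    Phi R s ≤ Phi R t :=
  Real.exp_le_exp.2 (mul_le_mul_of_nonneg_left
    (Real.sqrt_le_sqrt (Real.log_le_log hs h)) hR)

theorem Phi_one_div {R r : ℝ} : Phi R (1 / r) = Real.exp (R * √(-Real.log r)) := by
  simp [Phi, Real.log_inv]

/-- With `q = √(log (1/r))`, completing the square bounds `R q - (α - s) q²` by `R² / (4 (α - s))`.
-/
theorem exists_rpow_mul_Phi_le {α R s : ℝ} (hs : s < α) :
    ∃ C : ℝ, 0 < C ∧ ∀ r : ℝ, 0 < r → r < 1 → r ^ α * Phi R (1 / r) ≤ C * r ^ s := by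
  refine ⟨Real.exp (R ^ 2 / (4 * (α - s))), Real.exp_pos _, fun r hr hr1 => ?_⟩
  have ht : 0 ≤ -Real.log r := by linarith [Real.log_neg hr hr1]
  have hαs : 0 < α - s := sub_pos.2 hs
  rw [Phi_one_div, Real.rpow_def_of_pos hr, Real.rpow_def_of_pos hr, ← Real.exp_add, ← Real.exp_add,
    Real.exp_le_exp]
  have hsq := Real.sq_sqrt ht
  set q := √(-Real.log r)
  have hlog : Real.log r = -q ^ 2 := by linarith
  rw [hlog]
  have h1 : R ^ 2 / (4 * (α - s)) - R * q + (α - s) * q ^ 2 =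
      (R - 2 * (α - s) * q) ^ 2 / (4 * (α - s)) := by
    field_simp; ring
  have h2 : 0 ≤ (R - 2 * (α - s) * q) ^ 2 / (4 * (α - s)) := by positivity
  linarith

end PhiBounds

/-! ### From bounds at the scales `δ_k` to bounds at all radii. -/

section BallBounds

variable {d N : ℕ} {μ : ProbabilityMeasure (EuclideanSpace ℝ (Fin d))}

/-- The parameter `c` measures the loss in the number of selected cubes. The further `α` in the
gauge pays for replacing `r` by the next larger side length. -/
theorem exists_measure_ball_le (hN : 2 ≤ N) {α c A : ℝ} (hα : 0 ≤ α) (hc : 0 ≤ c) (hA : 0 < A)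
    {k₀ : ℕ} (h : ∀ k, k₀ ≤ k → ∀ x r, r ≤ sideLength (branching N) k →
      (μ : Measure (EuclideanSpace ℝ (Fin d))).real (Metric.ball x r) ≤
        A * Real.exp (c * (Real.log N * k) - α * (Real.log N * triangle k))) :
    ∃ C : ℝ, 0 < C ∧ ∀ x r, 0 < r →
      (μ : Measure (EuclideanSpace ℝ (Fin d))).real (Metric.ball x r) ≤
        C * (r ^ α * Phi ((c + α) * √(2 * Real.log N)) (1 / r)) := by
  have hL := log_pos_of_two_le hN
  set L := Real.log N
  set R := (c + α) * √(2 * L)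
  have hR : 0 ≤ R := by positivity
  -- Since `triangle (k + 1) = triangle k + k + 1`, passing between scales costs `α L k`, which goes
  -- to the gauge, and the constant `α L`. The second summand covers radii `r ≥ δ_(k₀)`, where the
  -- trivial bound `1` is used.
  refine ⟨A * Real.exp (α * L) + Real.exp (α * (L * triangle k₀)), by positivity, fun x r hr => ?_⟩
  have hP := one_le_Phi hR (1 / r)
  have hr0 : 0 < r ^ α := Real.rpow_pos_of_pos hr α
  rw [add_mul]
  by_cases hlt : L * triangle k₀ < -Real.log r
  · obtain ⟨k, hk, hk1, hk2⟩ := exists_scale hN hlt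
    have hrk : r ≤ sideLength (branching N) k := by
      rw [sideLength_branching hN, ← Real.log_le_iff_le_exp hr]
      change _ ≤ -(L * _)
      linarith
    refine (h k hk x r hrk).trans (le_add_of_le_of_nonneg ?_ (by positivity))
    rw [mul_assoc]
    gcongr
    rw [Phi_one_div, Real.rpow_def_of_pos hr, ← Real.exp_add, ← Real.exp_add, Real.exp_le_exp]
    have h1 := mul_le_sqrt hN hk1.le
    change L * k ≤ √(2 * L) * √(-Real.log r) at h1
    have h2 : (c + α) * (L * k) ≤ R * √(-Real.log r) := by
      rw [mul_assoc]; gcongr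
    change _ ≤ L * triangle (k + 1) at hk2
    rw [triangle_succ] at hk2
    have h3 := mul_le_mul_of_nonneg_left hk2 hα
    linarith
  · refine (measureReal_le_one).trans (le_add_of_nonneg_of_le (by positivity) ?_)
    calc (1 : ℝ) ≤ Real.exp (α * (L * triangle k₀)) * r ^ α := by
          rw [Real.rpow_def_of_pos hr, ← Real.exp_add]
          refine Real.one_le_exp ?_
          nlinarith
      _ ≤ _ := by
          gcongr
          exact le_mul_of_one_le_right hr0.le hP

theorem exists_le_measure_ball (hN : 2 ≤ N) {α B : ℝ} (hα : 0 ≤ α) (hB : 0 < B) {k₀ : ℕ}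
    {v : EuclideanSpace ℝ (Fin d)}
    (h : ∀ k, k₀ ≤ k → ∃ i : MultiIndex (branching N) d k, v ∈ cube i ∧
      B * Real.exp (-(α * (Real.log N * triangle k))) ≤
        (μ : Measure (EuclideanSpace ℝ (Fin d))).real (cube i)) :
    ∃ C : ℝ, 0 < C ∧ ∀ r, 0 < r → r < 1 →
      C⁻¹ ≤ (μ : Measure (EuclideanSpace ℝ (Fin d))).real (Metric.ball v r) * r ^ (-α) *
        Phi (α * (d + 1) * √(2 * Real.log N)) (1 / r) := by
  have hL := log_pos_of_two_le hN
  set L := Real.log N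
  set R := α * (d + 1) * √(2 * L)
  have hR : 0 ≤ R := by positivity
  -- Because `d < 2 ^ d ≤ N ^ d`, going `d` generations past `k + 1` makes the cube containing `v`
  -- so small that it fits into the ball of radius `r ≥ δ_(k+1)`.
  have key : ∀ k, k₀ ≤ k → ∀ r, -Real.log r ≤ L * triangle (k + 1) → 0 < r →
      B * Real.exp (-(α * (L * triangle (k + (d + 1))))) ≤
        (μ : Measure (EuclideanSpace ℝ (Fin d))).real (Metric.ball v r) := by
    intro k hk r hr hr0
    obtain ⟨i, hvi, hi⟩ := h (k + (d + 1)) (by omega)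
    refine hi.trans (measureReal_mono fun y hy => ?_)
    rw [Metric.mem_ball]
    refine (dist_le_of_mem_cube hy hvi).trans_lt ?_
    rw [sideLength_branching hN]
    calc (d : ℝ) * Real.exp (-(L * triangle (k + (d + 1))))
        < Real.exp (L * d) * Real.exp (-(L * triangle (k + (d + 1)))) := by
          gcongr
          have h2 : Real.exp (L * d) = (N : ℝ) ^ d := by
            rw [mul_comm, Real.exp_nat_mul, Real.exp_log (by positivity)]
          rw [h2]
          calc (d : ℝ) < (2 : ℝ) ^ d := by exact_mod_cast Nat.lt_two_pow_self
            _ ≤ (N : ℝ) ^ d := by gcongr; exact_mod_cast hN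
      _ = Real.exp (L * d - L * triangle (k + (d + 1))) := by rw [← Real.exp_add]; rfl
      _ ≤ r := by
          rw [← Real.le_log_iff_exp_le hr0]
          have h3 : triangle (k + 1) + d ≤ triangle (k + (d + 1)) := by
            rw [show k + (d + 1) = (k + 1) + d by ring, triangle_add (k + 1) d]
            have := triangle_nonneg d
            have : (0 : ℝ) ≤ d * k := by positivity
            push_cast
            linarith
          nlinarith
  -- `triangle (k + d + 1)` exceeds `triangle k` by `(d + 1) k`, which goes to the gauge, and by the
  -- constant `triangle (d + 1)` absorbed in `B'`. The constant `B''` handles `r ≥ δ_(k₀)`.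
  set B' := B * Real.exp (-(α * (L * triangle (d + 1)))) with hB'
  set B'' := B * Real.exp (-(α * (L * triangle (k₀ + (d + 1))))) with hB''
  refine ⟨(min B' B'')⁻¹, by positivity, fun r hr hr1 => ?_⟩
  have hlog := Real.log_neg hr hr1
  have hP := one_le_Phi hR (1 / r)
  rw [inv_inv]
  by_cases hlt : L * triangle k₀ < -Real.log r
  · obtain ⟨k, hk, hk1, hk2⟩ := exists_scale hN hlt
    refine (min_le_left _ _).trans ?_
    calc B' = B * Real.exp (-(α * (L * triangle (k + (d + 1))))) *
          Real.exp (α * (L * triangle k) + α * (d + 1) * (L * k)) := by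
          rw [hB', mul_assoc, ← Real.exp_add, triangle_add k (d + 1)]
          congr 2
          push_cast
          ring
      _ ≤ (μ : Measure (EuclideanSpace ℝ (Fin d))).real (Metric.ball v r) *
          Real.exp (α * (L * triangle k) + α * (d + 1) * (L * k)) := by
          gcongr
          exact key k hk r hk2 hr
      _ ≤ (μ : Measure (EuclideanSpace ℝ (Fin d))).real (Metric.ball v r) *
          (r ^ (-α) * Phi R (1 / r)) := by
          gcongr
          rw [Phi_one_div, Real.rpow_def_of_pos hr, ← Real.exp_add, Real.exp_le_exp]
          have h1 := mul_le_sqrt hN hk1.le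
          change L * k ≤ √(2 * L) * √(-Real.log r) at h1
          have h2 : α * (d + 1) * (L * k) ≤ R * √(-Real.log r) := by
            rw [mul_assoc (α * (d + 1))]; gcongr
          change L * triangle k < _ at hk1
          nlinarith
      _ = _ := by ring
  · refine (min_le_right _ _).trans ?_
    have h0 : -Real.log r ≤ L * triangle (k₀ + 1) := by
      refine (not_lt.1 hlt).trans ?_
      gcongr
      rw [triangle_succ]
      have : (0 : ℝ) ≤ k₀ := by positivity
      linarith
    have h1 := key k₀ le_rfl r h0 hr
    have h2 : 1 ≤ r ^ (-α) := Real.one_le_rpow_of_pos_of_le_one_of_nonpos hr hr1.le (by linarith)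
    calc B'' ≤ (μ : Measure (EuclideanSpace ℝ (Fin d))).real (Metric.ball v r) * 1 * 1 := by
          rw [mul_one, mul_one]; exact h1
      _ ≤ _ := by gcongr

end BallBounds

/-! ### Hausdorff dimension and singularity. -/

section Dimension

variable {d N : ℕ} {μ : ProbabilityMeasure (EuclideanSpace ℝ (Fin d))}

theorem ediam_cube_le {b : ℕ → ℕ} {k : ℕ} (i : MultiIndex b d k) :
    Metric.ediam (cube i) ≤ ENNReal.ofReal (d * sideLength b k) := by
  refine Metric.ediam_le fun x hx y hy => ?_
  rw [edist_dist]
  exact ENNReal.ofReal_le_ofReal (dist_le_of_mem_cube hx hy)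

/-- Covering by the selected cubes keeps `Z_k (d δ_k)^α` bounded, so the `α`-dimensional Hausdorff
measure is finite. -/
theorem dimH_cantorSet_le (hN : 2 ≤ N) {α C : ℝ} (hα : 0 ≤ α)
    {ω : Sample (branching N) d} {k₀ : ℕ}
    (h : ∀ k, k₀ ≤ k → (selected ω k).card ≤ C * Real.exp (α * (Real.log N * triangle k))) :
    dimH (cantorSet ω) ≤ ENNReal.ofReal α := by
  have hs := tendsto_sideLength_branching hN
  lift α to NNReal using hα
  rw [ENNReal.ofReal_coe_nnreal]
  refine dimH_le_of_hausdorffMeasure_ne_top (ne_top_of_le_ne_top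
    (b := ENNReal.ofReal (C * (d : ℝ) ^ (α : ℝ))) ENNReal.ofReal_ne_top ?_)
  refine (Measure.hausdorffMeasure_le_liminf_sum (ι := fun k => selected ω k) (l := atTop) (α : ℝ)
    (cantorSet ω) (fun k => ENNReal.ofReal (d * sideLength (branching N) k)) ?_
    (fun k i => cube (i : MultiIndex (branching N) d k)) ?_ ?_).trans ?_
  · have := ENNReal.tendsto_ofReal (hs.const_mul (d : ℝ))
    simpa using this
  · exact Eventually.of_forall fun k i => ediam_cube_le _
  · refine Eventually.of_forall fun k x hx => ?_
    have := mem_iInter.1 hx k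
    rw [prefractal_eq] at this
    simpa using this
  · refine liminf_le_of_frequently_le' (Eventually.frequently ?_)
    filter_upwards [eventually_ge_atTop k₀] with k hk
    calc ∑ i : selected ω k, Metric.ediam (cube (i : MultiIndex (branching N) d k)) ^ (α : ℝ)
        ≤ ∑ _i : selected ω k, ENNReal.ofReal (d * sideLength (branching N) k) ^ (α : ℝ) := by
          gcongr with i
          exact ediam_cube_le _
      _ = ENNReal.ofReal ((selected ω k).card * (d * sideLength (branching N) k) ^ (α : ℝ)) := by
          have hsl := (sideLength_pos (branching_pos hN) k).le
          rw [ENNReal.ofReal_mul (p := ((selected ω k).card : ℝ)) (by positivity),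
            ENNReal.ofReal_natCast, ENNReal.ofReal_rpow_of_nonneg (by positivity) (by positivity)]
          simp
      _ ≤ _ := by
          refine ENNReal.ofReal_le_ofReal ?_
          have hsl := sideLength_pos (branching_pos hN) k
          rw [Real.mul_rpow (by positivity) hsl.le]
          calc _ ≤ C * Real.exp (α * (Real.log N * triangle k)) *
                ((d : ℝ) ^ (α : ℝ) * sideLength (branching N) k ^ (α : ℝ)) := by
                gcongr
                exact h k hk
            _ = C * (d : ℝ) ^ (α : ℝ) * (Real.exp (α * (Real.log N * triangle k)) *
                sideLength (branching N) k ^ (α : ℝ)) := by ring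
            _ = C * (d : ℝ) ^ (α : ℝ) := by
                rw [sideLength_branching hN, ← Real.exp_mul, ← Real.exp_add]
                ring_nf
                simp

/-- The mass distribution principle for every `s < α`: the gauge costs only an arbitrarily small
power of `r`. -/
theorem le_dimH_of_measure_ball_le {α R C : ℝ} {E : Set (EuclideanSpace ℝ (Fin d))}
    (hμE : (μ : Measure (EuclideanSpace ℝ (Fin d))) Eᶜ = 0)
    (h : ∀ x r, 0 < r → (μ : Measure (EuclideanSpace ℝ (Fin d))).real (Metric.ball x r) ≤
      C * (r ^ α * Phi R (1 / r))) (hC : 0 < C) :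
    ENNReal.ofReal α ≤ dimH E := by
  refine le_of_forall_lt fun s' hs' => ?_
  obtain ⟨s, hs1, hs2⟩ := ENNReal.lt_iff_exists_nnreal_btwn.1 hs'
  refine hs1.trans_le (le_dimH_of_hausdorffMeasure_ne_zero ?_)
  have hsα : (s : ℝ) < α := by
    rw [ENNReal.lt_ofReal_iff_toReal_lt (by simp)] at hs2
    simpa using hs2
  obtain ⟨C', hC', hr⟩ := exists_rpow_mul_Phi_le (R := R) hsα
  have hD : 0 < C * C' := by positivity
  have hball : ∀ x r, 0 < r → r < 1 →
      (μ : Measure (EuclideanSpace ℝ (Fin d))).real (Metric.ball x r) ≤ C * C' * r ^ (s : ℝ) := by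
    intro x r hr0 hr1
    refine (h x r hr0).trans ?_
    rw [mul_assoc]
    exact mul_le_mul_of_nonneg_left (hr r hr0 hr1) hC.le
  have hle : (ENNReal.ofReal (C * C'))⁻¹ • (μ : Measure (EuclideanSpace ℝ (Fin d))) ≤
      Measure.hausdorffMeasure (s : ℝ) := by
    refine Measure.le_hausdorffMeasure _ _ (1 / 2) (by simp) fun S hS => ?_
    rcases S.eq_empty_or_nonempty with rfl | ⟨x, hx⟩
    · simp
    have hSt : Metric.ediam S ≠ ⊤ := ne_top_of_le_ne_top (by simp) hS
    have hdiam : Metric.ediam S = ENNReal.ofReal (Metric.diam S) :=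
      (ENNReal.ofReal_toReal hSt).symm
    have hρ : Metric.diam S < 1 := by
      have : Metric.diam S ≤ 1 / 2 := by
        have := ENNReal.toReal_mono (by simp) hS
        simpa [Metric.diam] using this
      linarith
    have hμS : (μ : Measure (EuclideanSpace ℝ (Fin d))).real S ≤
        C * C' * Metric.diam S ^ (s : ℝ) := by
      -- A set need not lie in an open ball of radius equal to its diameter, which may even be zero,
      -- so slightly larger radii are used and then decreased to the diameter.
      have hcont : Tendsto (fun r : ℝ => C * C' * r ^ (s : ℝ)) (𝓝[>] (Metric.diam S))
          (𝓝 (C * C' * Metric.diam S ^ (s : ℝ))) :=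
        ((Real.continuousAt_rpow_const _ _ (Or.inr s.coe_nonneg)).const_mul _).tendsto.mono_left
          nhdsWithin_le_nhds
      refine ge_of_tendsto hcont ?_
      filter_upwards [Ioo_mem_nhdsGT hρ] with r hr'
      refine (measureReal_mono fun y hy => ?_).trans
        (hball x r (Metric.diam_nonneg.trans_lt hr'.1) hr'.2)
      exact (Metric.dist_le_diam_of_mem' hSt hy hx).trans_lt hr'.1
    rw [Measure.smul_apply, smul_eq_mul, hdiam,
      ENNReal.ofReal_rpow_of_nonneg Metric.diam_nonneg s.coe_nonneg,
      ENNReal.inv_mul_le_iff (by simpa using hD) ENNReal.ofReal_ne_top,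
      ← ENNReal.ofReal_mul hD.le, ENNReal.le_ofReal_iff_toReal_le (measure_ne_top _ _)
        (by have := Metric.diam_nonneg (s := S); positivity)]
    exact hμS
  intro h0
  have h1 := hle E
  rw [h0, Measure.smul_apply, smul_eq_mul, nonpos_iff_eq_zero, mul_eq_zero] at h1
  rcases h1 with h1 | h1
  · simp at h1
  · have : (μ : Measure (EuclideanSpace ℝ (Fin d))) univ = 0 := by
      rw [← union_compl_self E]
      exact measure_union_null h1 hμE
    simp at this

theorem mutuallySingular_of_isCantorMeasure (hN : 2 ≤ N) {C c : ℝ} (hc : 0 < c)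
    {ω : Sample (branching N) d} (hμ : IsCantorMeasure ω μ) {k₀ : ℕ}
    (h : ∀ k, k₀ ≤ k → (selected ω k).card ≤
      C * Real.exp (d * (Real.log N * triangle k) - c * k)) :
    (μ : Measure (EuclideanSpace ℝ (Fin d))) ⟂ₘ volume := by
  refine ⟨(cantorSet ω)ᶜ, (isClosed_cantorSet ω).measurableSet.compl, hμ.1, ?_⟩
  rw [compl_compl]
  have hlim : Tendsto (fun k : ℕ => ENNReal.ofReal (C * Real.exp (-(c * k)))) atTop (𝓝 0) := by
    have h1 : Tendsto (fun k : ℕ => Real.exp (-(c * k))) atTop (𝓝 0) :=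
      Real.tendsto_exp_atBot.comp (tendsto_neg_atTop_atBot.comp
        (Tendsto.const_mul_atTop hc tendsto_natCast_atTop_atTop))
    simpa using ENNReal.tendsto_ofReal (h1.const_mul C)
  refine le_antisymm (ge_of_tendsto hlim ?_) zero_le
  filter_upwards [eventually_ge_atTop k₀] with k hk
  refine (measure_mono (iInter_subset _ k)).trans ?_
  have hsl := (sideLength_pos (branching_pos hN) k).le
  have hv : volume (prefractal ω k) =
      ENNReal.ofReal ((selected ω k).card * sideLength (branching N) k ^ d) := by
    rw [volume_prefractal (branching_pos hN), ENNReal.ofReal_mul (by positivity),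
      ENNReal.ofReal_pow hsl]
    simp
  rw [hv]
  refine ENNReal.ofReal_le_ofReal ?_
  calc _ ≤ C * Real.exp (d * (Real.log N * triangle k) - c * k) *
        sideLength (branching N) k ^ d := by
        gcongr
        exact h k hk
    _ = _ := by
        rw [sideLength_branching hN, ← Real.exp_nat_mul, mul_assoc, ← Real.exp_add]
        ring_nf

end Dimension
-- Chernoff bounds for sums of Bernoulli variables.
section Chernoff

variable {ι : Type*} [Fintype ι]

/-- Independence and `1 + x ≤ exp x` bound the binomial moment generating function by the Poisson
one of the same mean. -/
theorem mgf_card_filter_le (p : unitInterval) (S : Finset ι) (t : ℝ) :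
    mgf (fun y : ι → Bool => ((S.filter fun j => y j = true).card : ℝ))
      (Measure.pi fun _ => bernoulliMeasure true false p) t ≤
      Real.exp (S.card * (p : ℝ) * (Real.exp t - 1)) := by
  classical
  have h1 : ∀ y : ι → Bool, Real.exp (t * ((S.filter fun j => y j = true).card : ℝ)) =
      ∏ j, (fun j v => if j ∈ S ∧ v = true then Real.exp t else 1 : ι → Bool → ℝ) j (y j) := by
    intro y
    rw [mul_comm, Real.exp_nat_mul, Finset.prod_ite, Finset.prod_const_one, mul_one,
      Finset.prod_const]
    congr 2
    ext j; simp
  rw [mgf]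
  simp only [h1]
  rw [integral_fintype_prod_eq_prod
    (fun j v => if j ∈ S ∧ v = true then Real.exp t else 1 : ι → Bool → ℝ)]
  simp only [integral_bernoulliMeasure, and_true, smul_eq_mul]
  have h2 : ∀ j, (p : ℝ) * (if j ∈ S then Real.exp t else 1) +
      (1 - (p : ℝ)) * (if j ∈ S ∧ false = true then Real.exp t else 1) ≤
      if j ∈ S then Real.exp ((p : ℝ) * (Real.exp t - 1)) else 1 := by
    intro j
    by_cases hj : j ∈ S
    · simp only [hj, if_true, Bool.false_eq_true, and_false, if_false]
      have := Real.add_one_le_exp ((p : ℝ) * (Real.exp t - 1))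
      linarith
    · simp [hj]
  refine (Finset.prod_le_prod (fun j _ => ?_) fun j _ => h2 j).trans (le_of_eq ?_)
  · have := p.2.1
    have := sub_nonneg.2 p.2.2
    have h3 := Real.exp_pos t
    split_ifs <;> positivity
  · rw [Finset.prod_ite, Finset.prod_const_one, mul_one, Finset.prod_const, ← Real.exp_nat_mul]
    congr 1
    rw [Finset.filter_mem_eq_inter, Finset.univ_inter]
    ring

/-- The choice `t = η / 2` with `exp t - 1 ≤ t + t²` gives the exponent `η/2 + η²/4 - (η/2)(1 + η) =
-η²/4` per unit of mean. -/
theorem chernoff_upper (p : unitInterval) (S : Finset ι) {η : ℝ} (h0 : 0 ≤ η) (h1 : η ≤ 1) :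
    (Measure.pi fun _ : ι => bernoulliMeasure true false p).real
      {y | S.card * (p : ℝ) * (1 + η) ≤ ((S.filter fun j => y j = true).card : ℝ)} ≤
      Real.exp (-(S.card * (p : ℝ) * η ^ 2 / 4)) := by
  have hM : 0 ≤ (S.card : ℝ) * (p : ℝ) := mul_nonneg (by positivity) p.2.1
  refine (measure_ge_le_exp_mul_mgf (t := η / 2) _ (by positivity) .of_finite).trans ?_
  calc _ ≤ Real.exp (-(η / 2) * (S.card * (p : ℝ) * (1 + η))) *
        Real.exp (S.card * (p : ℝ) * (Real.exp (η / 2) - 1)) := by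
        gcongr
        exact mgf_card_filter_le p S _
    _ ≤ _ := by
        rw [← Real.exp_add, Real.exp_le_exp]
        have h2 := (abs_le.1 (Real.abs_exp_sub_one_sub_id_le (x := η / 2)
          (by rw [abs_le]; constructor <;> linarith))).2
        have h3 : Real.exp (η / 2) - 1 ≤ η / 2 + (η / 2) ^ 2 := by linarith
        have h4 := mul_le_mul_of_nonneg_left h3 hM
        linarith

theorem chernoff_lower (p : unitInterval) (S : Finset ι) {η : ℝ} (h0 : 0 ≤ η) (h1 : η ≤ 1) :
    (Measure.pi fun _ : ι => bernoulliMeasure true false p).real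
      {y | ((S.filter fun j => y j = true).card : ℝ) ≤ S.card * (p : ℝ) * (1 - η)} ≤
      Real.exp (-(S.card * (p : ℝ) * η ^ 2 / 4)) := by
  have hM : 0 ≤ (S.card : ℝ) * (p : ℝ) := mul_nonneg (by positivity) p.2.1
  refine (measure_le_le_exp_mul_mgf (t := -(η / 2)) _ (by linarith) .of_finite).trans ?_
  calc _ ≤ Real.exp (-(-(η / 2)) * (S.card * (p : ℝ) * (1 - η))) *
        Real.exp (S.card * (p : ℝ) * (Real.exp (-(η / 2)) - 1)) := by
        gcongr
        exact mgf_card_filter_le p S _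
    _ ≤ _ := by
        rw [← Real.exp_add, Real.exp_le_exp]
        have h2 := (abs_le.1 (Real.abs_exp_sub_one_sub_id_le (x := -(η / 2))
          (by rw [abs_le]; constructor <;> linarith))).2
        have h3 : Real.exp (-(η / 2)) - 1 ≤ -(η / 2) + (η / 2) ^ 2 := by linarith
        have h4 := mul_le_mul_of_nonneg_left h3 hM
        linarith

end Chernoff

/-- Weierstrass' product inequality; it bounds the probability of infinitely many independent good
events from below. -/
theorem one_sub_sum_le_prod {s : Finset ℕ} {f g : ℕ → ℝ} (hg0 : ∀ i, 0 ≤ g i) (hg1 : ∀ i, g i ≤ 1)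
    (h : ∀ i, 1 - f i ≤ g i) : 1 - ∑ i ∈ s, f i ≤ ∏ i ∈ s, g i := by
  classical
  induction s using Finset.induction_on with
  | empty => simp
  | insert i s hi ih =>
    rw [Finset.sum_insert hi, Finset.prod_insert hi]
    have h1 : 0 ≤ ∏ i ∈ s, g i := Finset.prod_nonneg fun i _ => hg0 i
    have h2 : ∏ i ∈ s, g i ≤ 1 := Finset.prod_le_one (fun i _ => hg0 i) fun i _ => hg1 i
    have := h i
    have := hg1 i
    nlinarith [mul_nonneg (sub_nonneg.2 (hg1 i)) (sub_nonneg.2 h2)]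

/-! ### Almost sure control and positive probability of survival. -/

section Percolation

variable {b : ℕ → ℕ} {e : ℕ → ℝ} {d : ℕ}

/-- The law of the binary string `Y_{k+1}`. -/
noncomputable def levelLaw (b : ℕ → ℕ) (e : ℕ → ℝ) (d k : ℕ) :
    Measure (MultiIndex b d (k + 1) → Bool) :=
  Measure.pi fun _ => bernoulliMeasure true false (selProb b e d (k + 1))

instance (k : ℕ) : IsProbabilityMeasure (levelLaw b e d k) := by
  unfold levelLaw; infer_instance

theorem auxProb_eq : auxProb b e d = Measure.infinitePi (levelLaw b e d) := rfl

instance : IsProbabilityMeasure (auxProb b e d) := by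
  rw [auxProb_eq]; infer_instance

/-- The expected number of retained extensions of a multi-index of length `k`. -/
noncomputable def offspringMean (b : ℕ → ℕ) (e : ℕ → ℝ) (d k : ℕ) : ℝ :=
  (b (k + 1) : ℝ) ^ d * (selProb b e d (k + 1) : ℝ)

/-- The binary strings for which all offspring numbers are close to `offspringMean`. -/
def goodStrings (b : ℕ → ℕ) (e : ℕ → ℝ) (d k : ℕ) : Set (MultiIndex b d (k + 1) → Bool) :=
  {y | ∀ i : MultiIndex b d k,
    offspringMean b e d k * (tol k / tol (k + 1)) ≤ childCount y i ∧
      childCount y i ≤ offspringMean b e d k * (tol (k + 1) / tol k)}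

/-- A bound for the probability of the complement of `goodStrings`. -/
noncomputable def failureBound (b : ℕ → ℕ) (e : ℕ → ℝ) (d k : ℕ) : ℝ :=
  (bigM b k : ℝ) ^ d * (2 * Real.exp (-(offspringMean b e d k * (1 / ((k : ℝ) + 2) ^ 2) ^ 2 / 4)))

theorem offspringMean_nonneg (k : ℕ) : 0 ≤ offspringMean b e d k :=
  mul_nonneg (by positivity) (selProb b e d (k + 1)).2.1

/-- The union bound runs over all `M_k^d` multi-indices, selected or not. Good events of different
levels are therefore independent, and no conditioning on the past is needed. -/
theorem levelLaw_compl_goodStrings_le (k : ℕ) :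
    (levelLaw b e d k).real (goodStrings b e d k)ᶜ ≤ failureBound b e d k := by
  classical
  set η : ℝ := 1 / ((k : ℝ) + 2) ^ 2 with hη
  have hη0 : 0 < η := by positivity
  have hη1 : η < 1 := by
    rw [hη, div_lt_one (by positivity)]
    have : (0 : ℝ) ≤ k := by positivity
    nlinarith
  have hm := offspringMean_nonneg (b := b) (e := e) (d := d) k
  let S : MultiIndex b d k → Finset (MultiIndex b d (k + 1)) := fun i =>
    Finset.univ.filter fun j => MultiIndex.trunc (Nat.le_succ k) j = i
  have hS : ∀ i, ((S i).card : ℝ) * (selProb b e d (k + 1) : ℝ) = offspringMean b e d k := by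
    intro i
    simp only [S, card_extensions, offspringMean]
    push_cast
    rfl
  have hsub : (goodStrings b e d k)ᶜ ⊆ ⋃ i : MultiIndex b d k,
      ({y | (((S i).filter fun j => y j = true).card : ℝ) ≤
          (S i).card * (selProb b e d (k + 1) : ℝ) * (1 - η)} ∪
       {y | (S i).card * (selProb b e d (k + 1) : ℝ) * (1 + η) ≤
          (((S i).filter fun j => y j = true).card : ℝ)}) := by
    intro y hy
    simp only [goodStrings, mem_compl_iff, mem_ofPred_eq, not_forall] at hy
    obtain ⟨i, hi⟩ := hy
    refine mem_iUnion.2 ⟨i, ?_⟩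
    rw [not_and_or, not_le, not_le] at hi
    rcases hi with hi | hi
    · left
      rw [tol_ratio] at hi
      rw [mem_ofPred_eq, hS]
      exact hi.le
    · right
      rw [mem_ofPred_eq, hS]
      refine le_trans ?_ hi.le
      gcongr
      -- The upper tolerance is `1 / (1 - η)`, which is at least `1 + η`.
      rw [← inv_div, tol_ratio, ← hη, ← one_div, le_div_iff₀ (by linarith)]
      nlinarith
  calc _ ≤ _ := measureReal_mono hsub
    _ ≤ ∑ _i : MultiIndex b d k, (2 * Real.exp (-(offspringMean b e d k * η ^ 2 / 4))) := by
        refine (measureReal_iUnion_fintype_le _).trans (Finset.sum_le_sum fun i _ => ?_)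
        refine (measureReal_union_le _ _).trans ?_
        have h1 := chernoff_lower (selProb b e d (k + 1)) (S i) hη0.le hη1.le
        have h2 := chernoff_upper (selProb b e d (k + 1)) (S i) hη0.le hη1.le
        rw [two_mul]
        refine add_le_add (h1.trans ?_) (h2.trans ?_) <;> rw [hS i]
    _ = failureBound b e d k := by
        rw [Finset.sum_const, Finset.card_univ, card_multiIndex, nsmul_eq_mul, failureBound]
        push_cast
        rfl

theorem measurableSet_goodStrings (k : ℕ) : MeasurableSet (goodStrings b e d k) :=
  (Set.toFinite _).measurableSet

theorem measurableSet_cantorSet_nonempty (hb : ∀ k, 0 < b (k + 1)) :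
    MeasurableSet {ω : Sample b d | (cantorSet ω).Nonempty} := by
  have : {ω : Sample b d | (cantorSet ω).Nonempty} = ⋂ k, ⋃ i : MultiIndex b d k,
      ⋂ (m : ℕ) (hm : m < k), (fun ω : Sample b d =>
        ω m (MultiIndex.trunc (Nat.succ_le_of_lt hm) i)) ⁻¹' {true} := by
    ext ω
    simp only [mem_ofPred_eq, cantorSet_nonempty_iff hb, Finset.Nonempty, mem_selected, mem_iInter,
      mem_iUnion, Selected, mem_preimage, mem_singleton_iff]
  rw [this]
  refine MeasurableSet.iInter fun k => MeasurableSet.iUnion fun i => MeasurableSet.iInter fun m =>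
    MeasurableSet.iInter fun hm => ?_
  refine MeasurableSet.preimage (measurableSet_singleton _) ?_
  exact (measurable_pi_apply _).comp (measurable_pi_apply m)

theorem ae_exists_controlled (hs : Summable (failureBound b e d)) :
    ∀ᵐ ω ∂(auxProb b e d), ∃ k₀, Controlled (offspringMean b e d) k₀ ω := by
  have hle : ∀ k, auxProb b e d {ω | ω k ∈ (goodStrings b e d k)ᶜ} ≤
      ENNReal.ofReal (failureBound b e d k) := by
    intro k
    have h1 : auxProb b e d {ω | ω k ∈ (goodStrings b e d k)ᶜ} =
        levelLaw b e d k (goodStrings b e d k)ᶜ :=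
      (measurePreserving_eval_infinitePi (levelLaw b e d) k).measure_preimage
        (measurableSet_goodStrings k).compl.nullMeasurableSet
    rw [h1, ← ofReal_measureReal]
    exact ENNReal.ofReal_le_ofReal (levelLaw_compl_goodStrings_le k)
  have hsum : ∑' k, auxProb b e d {ω | ω k ∈ (goodStrings b e d k)ᶜ} ≠ ⊤ :=
    ne_top_of_le_ne_top hs.tsum_ofReal_ne_top (ENNReal.tsum_le_tsum hle)
  filter_upwards [ae_eventually_notMem hsum] with ω hω
  obtain ⟨k₀, hk₀⟩ := eventually_atTop.1 hω
  exact ⟨k₀, fun k hk => not_not.1 (hk₀ k hk)⟩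

/-- Retaining everything in the first `K` levels has a positive probability `c`. Independently, all
later levels are good with probability at least `1 / 2` when the tail of the failure bounds is below
`1 / 2`. Together these events force survival. -/
theorem auxProb_cantorSet_nonempty_ne_zero (hb : ∀ k, 0 < b (k + 1))
    (hp : ∀ k, 0 < (selProb b e d (k + 1) : ℝ)) (hs : Summable (failureBound b e d)) :
    auxProb b e d {ω | (cantorSet ω).Nonempty} ≠ 0 := by
  obtain ⟨K, hK⟩ : ∃ K, ∀ s : Finset ℕ, Disjoint s (Finset.range K) →
      ∑ k ∈ s, failureBound b e d k < 1 / 2 := by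
    obtain ⟨s, hs'⟩ := (summable_iff_vanishing_norm.1 hs) (1 / 2) (by norm_num)
    obtain ⟨K, hK⟩ := s.exists_nat_subset_range
    refine ⟨K, fun t ht => lt_of_abs_lt ?_⟩
    exact hs' t (Finset.disjoint_of_subset_right hK ht)
  let A : (k : ℕ) → Set (MultiIndex b d (k + 1) → Bool) := fun k =>
    if k < K then {fun _ => true} else goodStrings b e d k
  have hA : ∀ k, MeasurableSet (A k) := fun k => (Set.toFinite _).measurableSet
  have hpos : ∀ k, 0 < (levelLaw b e d k).real {fun _ => true} := by
    intro k
    rw [levelLaw, Measure.real, Measure.pi_singleton, ENNReal.toReal_prod]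
    refine Finset.prod_pos fun i _ => ?_
    rw [← Measure.real, bernoulliMeasure_real_apply_of_mem_of_notMem]
    · exact hp k
    all_goals simp
  set c : ℝ := ∏ k ∈ Finset.range K, (levelLaw b e d k).real {fun _ => true} with hc
  have hc0 : 0 < c := Finset.prod_pos fun k _ => hpos k
  have hbound : ∀ n, K ≤ n → ENNReal.ofReal (c * (1 / 2)) ≤
      auxProb b e d (((Finset.range n : Finset ℕ) : Set ℕ).pi A) := by
    intro n hn
    rw [auxProb_eq, Measure.infinitePi_pi _ fun k _ => hA k]
    have : ∏ k ∈ Finset.range n, levelLaw b e d k (A k) =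
        ENNReal.ofReal (∏ k ∈ Finset.range n, (levelLaw b e d k).real (A k)) := by
      rw [ENNReal.ofReal_prod_of_nonneg fun _ _ => measureReal_nonneg]
      exact Finset.prod_congr rfl fun k _ => (ofReal_measureReal).symm
    rw [this]
    refine ENNReal.ofReal_le_ofReal ?_
    rw [← Finset.prod_range_mul_prod_Ico _ hn]
    have e1 : ∏ k ∈ Finset.range K, (levelLaw b e d k).real (A k) = c := by
      refine Finset.prod_congr rfl fun k hk => ?_
      simp only [A, Finset.mem_range.1 hk, if_true]
    have e2 : ∏ k ∈ Finset.Ico K n, (levelLaw b e d k).real (A k) =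
        ∏ k ∈ Finset.Ico K n, (levelLaw b e d k).real (goodStrings b e d k) := by
      refine Finset.prod_congr rfl fun k hk => ?_
      simp only [A, not_lt.2 (Finset.mem_Ico.1 hk).1, if_false]
    rw [e1, e2]
    gcongr
    have h1 := hK (Finset.Ico K n) (by
      rw [Finset.range_eq_Ico]
      exact (Finset.Ico_disjoint_Ico_consecutive 0 K n).symm)
    refine le_trans ?_ (one_sub_sum_le_prod (f := failureBound b e d)
      (fun k => measureReal_nonneg) (fun k => measureReal_le_one) fun k => ?_)
    · linarith
    · have h2 := levelLaw_compl_goodStrings_le (b := b) (e := e) (d := d) k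
      rw [probReal_compl_eq_one_sub (measurableSet_goodStrings k)] at h2
      linarith
  -- The product formula is available for finitely many levels; continuity from above extends the
  -- uniform lower bound to all of them.
  have hlim : Tendsto (fun n => auxProb b e d (((Finset.range n : Finset ℕ) : Set ℕ).pi A)) atTop
      (𝓝 (auxProb b e d (⋂ n, ((Finset.range n : Finset ℕ) : Set ℕ).pi A))) := by
    refine tendsto_measure_iInter_atTop (fun n => ?_) (fun n n' hn => ?_) ⟨0, measure_ne_top _ _⟩
    · exact (MeasurableSet.pi (Finset.countable_toSet _) fun k _ => hA k).nullMeasurableSet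
    · exact Set.pi_mono' (fun k _ => subset_rfl) (by exact_mod_cast Finset.range_mono hn)
  have hge : ENNReal.ofReal (c * (1 / 2)) ≤
      auxProb b e d (⋂ n, ((Finset.range n : Finset ℕ) : Set ℕ).pi A) :=
    ge_of_tendsto hlim ((eventually_ge_atTop K).mono hbound)
  have hsub : (⋂ n, ((Finset.range n : Finset ℕ) : Set ℕ).pi A) ⊆
      {ω : Sample b d | (cantorSet ω).Nonempty} := by
    intro ω hω
    have hω' : ∀ k, ω k ∈ A k := fun k =>
      mem_iInter.1 hω (k + 1) k (by simp)
    have hcon : Controlled (offspringMean b e d) K ω := by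
      intro k hk
      have := hω' k
      simp only [A, not_lt.2 hk, if_false] at this
      exact this
    have hne : (selected ω K).Nonempty := by
      refine ⟨fun j a => ⟨0, hb j⟩, mem_selected.2 fun m hm => ?_⟩
      have := hω' m
      simp only [A, hm, if_true, mem_singleton_iff] at this
      rw [this]
    have hm : ∀ k, 0 < offspringMean b e d k := fun k => by
      have := hp k
      have := hb k
      unfold offspringMean
      positivity
    exact (cantorSet_nonempty_iff hb).2 (hcon.selected_nonempty hm hne)
  refine (lt_of_lt_of_le ?_ (hge.trans (measure_mono hsub))).ne'
  rw [ENNReal.ofReal_pos]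
  positivity

end Percolation
-- The specific branching numbers and selection probabilities.
section Parameters

variable {N d : ℕ} {ε γ : ℝ}

theorem epsSeq_nonneg (hε : 0 ≤ ε) (hγ : 0 ≤ γ) (k : ℕ) : 0 ≤ epsSeq ε γ k := by
  unfold epsSeq; split_ifs <;> positivity

theorem selProb_eq_exp (hN : 2 ≤ N) (hε : 0 ≤ ε) (hγ : 0 ≤ γ) (k : ℕ) :
    (selProb (branching N) (epsSeq ε γ) d (k + 1) : ℝ) =
      Real.exp (-(d * Real.log N * ((k + 1) * epsSeq ε γ (k + 1)))) := by
  have h0 : (0 : ℝ) < N := by positivity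
  rw [coe_selProb (branching_pos hN k) (epsSeq_nonneg hε hγ _), branching, Nat.cast_pow,
    Real.rpow_def_of_pos (by positivity), Real.log_pow]
  push_cast
  ring_nf

theorem offspringMean_eq_exp (hN : 2 ≤ N) (hε : 0 ≤ ε) (hγ : 0 ≤ γ) (k : ℕ) :
    offspringMean (branching N) (epsSeq ε γ) d k =
      Real.exp (d * Real.log N * ((k + 1) - (k + 1) * epsSeq ε γ (k + 1))) := by
  have h0 : (0 : ℝ) < N := by positivity
  rw [offspringMean, selProb_eq_exp hN hε hγ, branching, Nat.cast_pow, ← Real.exp_log h0,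
    Real.log_exp, ← Real.exp_nat_mul, ← Real.exp_nat_mul, ← Real.exp_add]
  push_cast
  ring_nf

/-- For `ε = 0` the choice `ε_k = γ / k` makes every selection probability equal to `N^(-dγ)`, so
each generation loses the same factor; for `ε > 0` the loss is proportional to `triangle k` and
lowers the dimension. -/
theorem prod_offspringMean_eq_exp (hN : 2 ≤ N) (hε : 0 ≤ ε) (hγ : 0 ≤ γ) (k : ℕ) :
    ∏ j ∈ Finset.range k, offspringMean (branching N) (epsSeq ε γ) d j =
      Real.exp (d * (1 - ε) * (Real.log N * triangle k) -
        if ε = 0 then d * γ * Real.log N * k else 0) := by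
  rw [Finset.prod_congr rfl fun j _ => offspringMean_eq_exp hN hε hγ j, ← Real.exp_sum]
  congr 1
  rw [← Finset.mul_sum, Finset.sum_sub_distrib, sum_range_add_one]
  by_cases h : ε = 0
  · simp only [epsSeq, h, if_true]
    have : ∀ j ∈ Finset.range k, ((j : ℝ) + 1) * (γ / ((j + 1 : ℕ) : ℝ)) = γ := by
      intro j _; push_cast; field_simp
    rw [Finset.sum_congr rfl this, Finset.sum_const, Finset.card_range, nsmul_eq_mul]
    ring
  · simp only [epsSeq, h, if_false]
    rw [← Finset.sum_mul, sum_range_add_one]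
    ring

theorem le_offspringMean (hN : 2 ≤ N) (hε : 0 ≤ ε) (hγ : 0 ≤ γ) (k : ℕ) :
    Real.exp (d * (1 - ε) * Real.log N * (k + 1) - d * γ * Real.log N) ≤
      offspringMean (branching N) (epsSeq ε γ) d k := by
  have hL := log_pos_of_two_le hN
  rw [offspringMean_eq_exp hN hε hγ, Real.exp_le_exp]
  have h1 : ((k : ℝ) + 1) * epsSeq ε γ (k + 1) ≤ ε * (k + 1) + γ := by
    unfold epsSeq
    split_ifs with h
    · rw [h]; push_cast; field_simp; linarith
    · linarith
  have h2 : (0 : ℝ) ≤ d * Real.log N := by positivity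
  nlinarith [mul_le_mul_of_nonneg_left h1 h2]

/-- The number of indices is only `exp(O(k²))`, whereas the Chernoff exponent is of order `m_k /
(k+2)^4` and `m_k` grows exponentially, because `ε < 1` and `d ≥ 1`. -/
theorem summable_failureBound (hN : 2 ≤ N) (hd : 1 ≤ d) (hε : 0 ≤ ε) (hε₁ : ε < 1) (hγ : 0 ≤ γ) :
    Summable (failureBound (branching N) (epsSeq ε γ) d) := by
  have hL := log_pos_of_two_le hN
  set L := Real.log N
  have hd' : (0 : ℝ) < d := by exact_mod_cast hd
  have hβ : 0 < d * (1 - ε) * L := by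
    have : 0 < 1 - ε := by linarith
    positivity
  set β := d * (1 - ε) * L
  have ho := (isLittleO_pow_exp_pos_mul_atTop 6 hβ).comp_tendsto
    (tendsto_atTop_add_const_right atTop (2 : ℝ) tendsto_natCast_atTop_atTop)
  -- With this `c`, eventually `m ≥ 4 (d L + 1) (k + 2)^6`. The Chernoff exponent is then at least
  -- `(d L + 1) (k + 2)²`, which beats `d L triangle k` with `k` to spare.
  set c := Real.exp (-β - d * γ * L) / (4 * (d * L + 1)) with hc
  have hev := ho.bound (c := c) (by positivity)
  have hsum : Summable fun k : ℕ => 2 * Real.exp (-(k : ℝ)) :=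
    (Real.summable_exp_neg_nat).mul_left 2
  refine summable_of_isBigO_nat hsum (Asymptotics.IsBigO.of_bound 1 ?_)
  filter_upwards [hev] with k hk
  simp only [Function.comp_apply, Real.norm_eq_abs] at hk
  rw [abs_of_nonneg (by positivity), abs_of_pos (Real.exp_pos _)] at hk
  have h0 : 0 ≤ failureBound (branching N) (epsSeq ε γ) d k := by unfold failureBound; positivity
  rw [one_mul, Real.norm_of_nonneg h0, Real.norm_of_nonneg (by positivity), failureBound,
    bigM_branching hN, ← Real.exp_nat_mul, mul_left_comm, ← Real.exp_add]
  gcongr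
  have hm := le_offspringMean (d := d) hN hε hγ k
  set m := offspringMean (branching N) (epsSeq ε γ) d k
  have h1 : 4 * (d * L + 1) * ((k : ℝ) + 2) ^ 6 ≤ m := by
    refine le_trans ?_ hm
    calc _ ≤ 4 * (d * L + 1) * (c * Real.exp (β * (k + 2))) := by gcongr
      _ = Real.exp (-β - d * γ * L) * Real.exp (β * (k + 2)) := by rw [hc]; field_simp
      _ = _ := by
        rw [← Real.exp_add]
        change _ = Real.exp (β * (k + 1) - d * γ * L)
        ring_nf
  have h2 : (d * L + 1) * ((k : ℝ) + 2) ^ 2 ≤ m * (1 / ((k : ℝ) + 2) ^ 2) ^ 2 / 4 := by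
    have : m * (1 / ((k : ℝ) + 2) ^ 2) ^ 2 / 4 = m / (4 * ((k : ℝ) + 2) ^ 4) := by
      field_simp
    rw [this, le_div_iff₀ (by positivity)]
    calc _ = 4 * (d * L + 1) * ((k : ℝ) + 2) ^ 6 := by ring
      _ ≤ m := h1
  have h3 : triangle k ≤ ((k : ℝ) + 2) ^ 2 := by
    unfold triangle
    have : (0 : ℝ) ≤ k := by positivity
    nlinarith
  have h4 : (k : ℝ) ≤ ((k : ℝ) + 2) ^ 2 := by
    have : (0 : ℝ) ≤ k := by positivity
    nlinarith
  have h5 : d * (L * triangle k) ≤ d * L * ((k : ℝ) + 2) ^ 2 := by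
    rw [← mul_assoc]; gcongr
  change d * (L * triangle k) + _ ≤ _
  linarith

end Parameters
-- Transport of the ball bounds to the manifold.
section ChartTransport
open scoped NNReal

theorem chartMeasure_apply {d : ℕ} {M : Type*} [TopologicalSpace M] [MeasurableSpace M]
    [BorelSpace M] {U : TopologicalSpace.Opens (EuclideanSpace ℝ (Fin d))} {u : U → M}
    (hu : Continuous u) (μ : Measure (EuclideanSpace ℝ (Fin d))) {A : Set M}
    (hA : MeasurableSet A) :
    chartMeasure u μ A = μ (Subtype.val '' (u ⁻¹' A)) := by
  have hmeas : MeasurableEmbedding (Subtype.val : U → EuclideanSpace ℝ (Fin d)) :=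
    MeasurableEmbedding.subtype_coe U.isOpen.measurableSet
  rw [chartMeasure, Measure.map_apply hu.measurable hA, hmeas.comap_apply]

/-- The centre `x` may lie off the image of `u`. If the ball meets the image of the cube at `u w`,
its preimage in the cube lies in a Euclidean ball about `w` of comparable radius; otherwise it is
null. -/
theorem chartBallCondition_of_measure_ball_le {n d : ℕ} {α R C : ℝ} (hR : 0 ≤ R)
    (hC : 0 < C) {μ : ProbabilityMeasure (EuclideanSpace ℝ (Fin d))}
    (hμ : (μ : Measure (EuclideanSpace ℝ (Fin d))) (unitCube d)ᶜ = 0)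
    (h : ∀ x r, 0 < r → (μ : Measure (EuclideanSpace ℝ (Fin d))).real (Metric.ball x r) ≤
      C * (r ^ α * Phi R (1 / r))) :
    ChartBallCondition.{v} n d α (Phi R) (μ : Measure (EuclideanSpace ℝ (Fin d))) := by
  intro M _ _ _ _ _ _ _ _ _ U u hU hu
  have huc : Continuous u := hu.isEmbedding.continuous
  have hK : IsCompact ((↑) ⁻¹' unitCube d : Set U) := by
    rw [Subtype.isCompact_iff, image_preimage_eq_of_subset (by simpa using hU)]
    exact isCompact_unitCube
  obtain ⟨L, hL, hLip⟩ := exists_edist_le_edist_of_isSmoothEmbedding hu hK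
  have hL' : (0 : ℝ) < L := by exact_mod_cast hL
  -- Two points of a ball of radius `r` are at distance at most `2 r`; the extra `1` makes the
  -- Euclidean inclusion strict and the new radius no smaller than `r`.
  refine ⟨C * (2 * L + 1) ^ α, by positivity, fun x r hr => ?_⟩
  rw [chartMeasure_apply huc _ Metric.isOpen_eball.measurableSet]
  set S : Set (EuclideanSpace ℝ (Fin d)) :=
    Subtype.val '' (u ⁻¹' Metric.eball x (ENNReal.ofReal r)) with hS
  have h1 : (μ : Measure (EuclideanSpace ℝ (Fin d))) S ≤
      (μ : Measure (EuclideanSpace ℝ (Fin d))) (S ∩ unitCube d) := by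
    calc _ ≤ (μ : Measure (EuclideanSpace ℝ (Fin d))) ((S ∩ unitCube d) ∪ (unitCube d)ᶜ) :=
          measure_mono fun y hy => by
            by_cases hyc : y ∈ unitCube d
            · exact Or.inl ⟨hy, hyc⟩
            · exact Or.inr hyc
      _ ≤ _ := (measure_union_le _ _).trans (by rw [hμ, add_zero])
  refine h1.trans ?_
  rcases (S ∩ unitCube d).eq_empty_or_nonempty with he | ⟨w, hw, hwc⟩
  · rw [he]; simp
  obtain ⟨w, hwx, rfl⟩ := hw
  have hρ : 0 < (2 * L + 1) * r := by positivity
  have hsub : S ∩ unitCube d ⊆ Metric.ball (w : EuclideanSpace ℝ (Fin d)) ((2 * L + 1) * r) := by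
    rintro _ ⟨⟨y, hyx, rfl⟩, hyc⟩
    have h2 := hLip y hyc w hwc
    have h3 : edist (u y) (u w) ≤ ENNReal.ofReal r + ENNReal.ofReal r := by
      refine (edist_triangle_right _ _ x).trans (add_le_add ?_ ?_)
      · exact (Metric.mem_eball.1 hyx).le
      · exact (Metric.mem_eball.1 hwx).le
    rw [← Metric.eball_ofReal, Metric.mem_eball]
    refine h2.trans_lt ?_
    calc (L : ℝ≥0∞) * edist (u y) (u w) ≤ L * (ENNReal.ofReal r + ENNReal.ofReal r) := by gcongr
      _ = ENNReal.ofReal (L * (r + r)) := by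
          rw [ENNReal.ofReal_mul (by positivity), ENNReal.ofReal_add hr.le hr.le,
            ENNReal.ofReal_coe_nnreal]
      _ < ENNReal.ofReal ((2 * L + 1) * r) := by
          rw [ENNReal.ofReal_lt_ofReal_iff hρ]
          nlinarith
  refine (measure_mono hsub).trans ?_
  rw [← ofReal_measureReal]
  refine ENNReal.ofReal_le_ofReal ((h w _ hρ).trans ?_)
  rw [Real.mul_rpow (by positivity) hr.le, mul_assoc, mul_assoc]
  gcongr
  refine Phi_mono_right hR (by positivity) ?_
  refine one_div_le_one_div_of_le hr ?_
  nlinarith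

/-- By `√(x + y) ≤ √x + √y`, the dilation by `L` changes the gauge by a bounded factor, while `(R' -
R) √(log (1/r))` tends to infinity. -/
theorem eventually_rpow_mul_Phi_le {R R' L α : ℝ} (hL : 1 ≤ L) (hR : R < R') (hR0 : 0 ≤ R) :
    ∀ᶠ r : ℝ in 𝓝[>] 0, L ^ α * Phi R (L / r) ≤ Phi R' (1 / r) := by
  have h1 : Tendsto (fun r : ℝ => (R' - R) * √(-Real.log r)) (𝓝[>] 0) atTop :=
    Tendsto.const_mul_atTop (sub_pos.2 hR)
      (Real.tendsto_sqrt_atTop.comp (tendsto_neg_atBot_atTop.comp Real.tendsto_log_nhdsGT_zero))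
  filter_upwards [h1.eventually_ge_atTop (α * Real.log L + R * √(Real.log L)),
    Ioo_mem_nhdsGT (zero_lt_one' ℝ)] with r hr hr01
  have hL0 : 0 < L := by linarith
  rw [Phi_one_div, Phi, Real.rpow_def_of_pos hL0, ← Real.exp_add, Real.exp_le_exp,
    Real.log_div hL0.ne' hr01.1.ne']
  have h2 : √(Real.log L - Real.log r) ≤ √(Real.log L) + √(-Real.log r) := by
    have h5 := Real.log_nonneg hL
    have h6 : 0 ≤ -Real.log r := by linarith [Real.log_neg hr01.1 hr01.2]
    have h7 := Real.sqrt_nonneg (Real.log L)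
    have h8 := Real.sqrt_nonneg (-Real.log r)
    rw [Real.sqrt_le_left (by positivity), add_sq, Real.sq_sqrt h5, Real.sq_sqrt h6]
    nlinarith [mul_nonneg h7 h8]
  have h3 := mul_le_mul_of_nonneg_left h2 hR0
  linarith

/-- The same `κ` serves every embedding: the dependence on the Lipschitz constant is absorbed by the
strict increase from `R` to `R'` as `r → 0`. -/
theorem chartLowerCondition_of_le_measure_ball {n d : ℕ} {α R R' κ : ℝ} (hR : R < R')
    (hR0 : 0 ≤ R) {μ : ProbabilityMeasure (EuclideanSpace ℝ (Fin d))}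
    {v : EuclideanSpace ℝ (Fin d)}
    (h : ∀ r, 0 < r → r < 1 →
      κ ≤ (μ : Measure (EuclideanSpace ℝ (Fin d))).real (Metric.ball v r) * r ^ (-α) *
        Phi R (1 / r)) :
    ChartLowerCondition.{v} n d α (Phi R') (μ : Measure (EuclideanSpace ℝ (Fin d))) v κ := by
  intro M _ _ _ _ _ _ _ _ _ U u hU hu w hw
  have huc : Continuous u := hu.isEmbedding.continuous
  obtain ⟨L, hL, hLip⟩ := exists_eventually_edist_le_of_contMDiffAt (w := w)
    ((hu.isImmersion.contMDiff w).of_le (by exact_mod_cast le_top))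
  obtain ⟨δ, hδ, hball⟩ : ∃ δ > 0, ∀ y ∈ Metric.ball (w : EuclideanSpace ℝ (Fin d)) δ,
      ∃ hy : y ∈ U, edist (u ⟨y, hy⟩) (u w) ≤ L * edist y w := by
    have h1 : ∀ᶠ y in 𝓝 (w : EuclideanSpace ℝ (Fin d)),
        ∃ hy : y ∈ U, edist (u ⟨y, hy⟩) (u w) ≤ L * edist y w := by
      have h2 := hLip
      rw [nhds_subtype_eq_comap, eventually_comap] at h2
      filter_upwards [h2, U.isOpen.mem_nhds w.2] with y hy hyU
      exact ⟨hyU, hy ⟨y, hyU⟩ rfl⟩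
    exact Metric.eventually_nhds_iff_ball.1 h1
  set Λ : ℝ := L + 1 with hΛ
  have hΛ1 : 1 ≤ Λ := by rw [hΛ]; have := L.coe_nonneg; linarith
  have hΛ0 : 0 < Λ := by linarith
  -- The bound in fact holds for all small `r`.
  refine le_limsup_of_frequently_le' (Eventually.frequently ?_)
  filter_upwards [eventually_rpow_mul_Phi_le (α := α) hΛ1 hR hR0,
    Ioo_mem_nhdsGT (lt_min (zero_lt_one' ℝ) hδ)] with r hr hr01
  obtain ⟨hr0, hr1⟩ := hr01
  have hrΛ : 0 < r / Λ := by positivity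
  have hrle : r / Λ ≤ r := div_le_self hr0.le hΛ1
  have hsub : Metric.ball v (r / Λ) ⊆
      Subtype.val '' (u ⁻¹' Metric.eball (u w) (ENNReal.ofReal r)) := by
    intro y hy
    rw [← hw] at hy
    obtain ⟨hyU, hyu⟩ := hball y (Metric.ball_subset_ball
      (hrle.trans (hr1.le.trans (min_le_right _ _))) hy)
    refine ⟨⟨y, hyU⟩, ?_, rfl⟩
    rw [mem_preimage, Metric.mem_eball]
    refine hyu.trans_lt ?_
    rw [edist_dist, ← ENNReal.ofReal_coe_nnreal, ← ENNReal.ofReal_mul (by positivity),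
      ENNReal.ofReal_lt_ofReal_iff hr0]
    rw [Metric.mem_ball, lt_div_iff₀ hΛ0] at hy
    have : (0 : ℝ) ≤ dist y w := dist_nonneg
    nlinarith
  have h3 := h (r / Λ) hrΛ (hrle.trans_lt (hr1.trans_le (min_le_left _ _)))
  rw [chartMeasure_apply huc _ Metric.isOpen_eball.measurableSet]
  have h4 : κ ≤ r ^ (-α) * Phi R' (1 / r) *
      (μ : Measure (EuclideanSpace ℝ (Fin d))).real (Metric.ball v (r / Λ)) := by
    refine h3.trans ?_
    have e1 : (r / Λ) ^ (-α) = r ^ (-α) * Λ ^ α := by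
      rw [Real.div_rpow hr0.le hΛ0.le, Real.rpow_neg hΛ0.le, div_inv_eq_mul]
    have e2 : 1 / (r / Λ) = Λ / r := by rw [one_div_div]
    rw [e1, e2]
    have hr' : 0 ≤ r ^ (-α) := by positivity
    calc _ = r ^ (-α) * (Λ ^ α * Phi R (Λ / r)) *
          (μ : Measure (EuclideanSpace ℝ (Fin d))).real (Metric.ball v (r / Λ)) := by ring
      _ ≤ _ := by gcongr
  calc ENNReal.ofReal κ ≤ ENNReal.ofReal (r ^ (-α) * Phi R' (1 / r) *
        (μ : Measure (EuclideanSpace ℝ (Fin d))).real (Metric.ball v (r / Λ))) :=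
        ENNReal.ofReal_le_ofReal h4
    _ = ENNReal.ofReal (r ^ (-α) * Phi R' (1 / r)) *
        (μ : Measure (EuclideanSpace ℝ (Fin d))) (Metric.ball v (r / Λ)) := by
        rw [ENNReal.ofReal_mul (mul_nonneg (by positivity) (Phi_pos _ _).le), ofReal_measureReal]
    _ ≤ _ := by gcongr

end ChartTransport
-- Assembly.
section Main

variable {N d : ℕ} {ε γ : ℝ}

/-- The Cantor measure of `E(ω)`, where it exists. -/
noncomputable def cantorMeasure {b : ℕ → ℕ} (ω : Sample b d) :
    ProbabilityMeasure (EuclideanSpace ℝ (Fin d)) :=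
  Classical.epsilon (IsCantorMeasure ω)

theorem isCantorMeasure_cantorMeasure {b : ℕ → ℕ} {ω : Sample b d}
    (h : ∃ μ, IsCantorMeasure ω μ) : IsCantorMeasure ω (cantorMeasure ω) :=
  Classical.epsilon_spec h

/-- The constant `C₁`. -/
noncomputable def gaugeConst (N d : ℕ) (ε γ : ℝ) : ℝ :=
  (d * γ + d * (1 - ε)) * √(2 * Real.log N) + d * (1 - ε) * (d + 1) * √(2 * Real.log N) + 1

/-- The lower bound carries the loss `N^(-dγk)` also when `ε > 0`, where it is superfluous but
harmless for the gauge; this treats both cases at once. -/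
theorem card_selected_bounds (hN : 2 ≤ N) (hε : 0 ≤ ε) (hγ : 0 ≤ γ)
    {ω : Sample (branching N) d} {k₀ : ℕ}
    (hω : Controlled (offspringMean (branching N) (epsSeq ε γ) d) k₀ ω)
    (hm : ∀ k, 0 < offspringMean (branching N) (epsSeq ε γ) d k)
    (hne : (selected ω k₀).Nonempty) :
    ∃ C : ℝ, 0 < C ∧ ∀ k, k₀ ≤ k →
      C⁻¹ * Real.exp (d * (1 - ε) * (Real.log N * triangle k) - d * γ * (Real.log N * k)) ≤
        (selected ω k).card ∧
      (selected ω k).card ≤ C * Real.exp (d * (1 - ε) * (Real.log N * triangle k)) ∧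
      (ε = 0 → (selected ω k).card ≤
        C * Real.exp (d * (Real.log N * triangle k) - d * γ * Real.log N * k)) := by
  have hL := log_pos_of_two_le hN
  obtain ⟨C, hC, h⟩ := hω.exists_card_selected_bounds hm hne
  refine ⟨C, hC, fun k hk => ?_⟩
  have hk' := h k hk
  rw [prod_offspringMean_eq_exp hN hε hγ] at hk'
  have hnn : 0 ≤ d * γ * Real.log N * k := by positivity
  refine ⟨le_trans ?_ hk'.1, hk'.2.trans ?_, fun h0 => hk'.2.trans ?_⟩
  · gcongr
    split_ifs <;> linarith
  · gcongr
    split_ifs <;> linarith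
  · simp [h0]

theorem cantorSet_properties (n : ℕ) (hd : 1 ≤ d) (hN : 2 ≤ N) (hε₀ : 0 ≤ ε) (hε₁ : ε < 1)
    (hγ₀ : 0 < γ) {ω : Sample (branching N) d} {k₀ : ℕ}
    (hω : Controlled (offspringMean (branching N) (epsSeq ε γ) d) k₀ ω)
    (hE : (cantorSet ω).Nonempty) {μ : ProbabilityMeasure (EuclideanSpace ℝ (Fin d))}
    (hμ : IsCantorMeasure ω μ) :
    (dimH (cantorSet ω) = ENNReal.ofReal ((d : ℝ) * (1 - ε)) ∧
      (ε = 0 → (μ : Measure (EuclideanSpace ℝ (Fin d))) ⟂ₘ volume)) ∧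
    ((∃ C₂ : ℝ, 0 < C₂ ∧ ∀ x ∈ unitCube d, ∀ r : ℝ, 0 < r →
        (μ : Measure (EuclideanSpace ℝ (Fin d))).real (Metric.ball x r)
          * r ^ (-((d : ℝ) * (1 - ε))) * (Phi (gaugeConst N d ε γ) (1 / r))⁻¹ ≤ C₂) ∧
      ChartBallCondition.{v} n d ((d : ℝ) * (1 - ε)) (Phi (gaugeConst N d ε γ))
        (μ : Measure (EuclideanSpace ℝ (Fin d)))) ∧
    (∀ v₀ ∈ cantorSet ω, ∃ C₀ : ℝ, 0 < C₀ ∧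
      (∀ r : ℝ, 0 < r → r < 1 →
        C₀⁻¹ ≤ (μ : Measure (EuclideanSpace ℝ (Fin d))).real (Metric.ball v₀ r)
          * r ^ (-((d : ℝ) * (1 - ε))) * Phi (gaugeConst N d ε γ) (1 / r)) ∧
      ChartLowerCondition.{v} n d ((d : ℝ) * (1 - ε)) (Phi (gaugeConst N d ε γ))
        (μ : Measure (EuclideanSpace ℝ (Fin d))) v₀ C₀⁻¹) := by
  have hL := log_pos_of_two_le hN
  have hb := branching_pos hN
  have hd' : (0 : ℝ) < d := by exact_mod_cast hd
  have hm : ∀ k, 0 < offspringMean (branching N) (epsSeq ε γ) d k := fun k => by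
    rw [offspringMean_eq_exp hN hε₀ hγ₀.le]; exact Real.exp_pos _
  have hne := (cantorSet_nonempty_iff hb).1 hE k₀
  have hα : 0 < (d : ℝ) * (1 - ε) := mul_pos hd' (by linarith)
  set α : ℝ := d * (1 - ε) with hαdef
  obtain ⟨C, hC, hcard⟩ := card_selected_bounds hN hε₀ hγ₀.le hω hm hne
  have hZ : ∀ k, (0 : ℝ) < (selected ω k).card := fun k => by
    exact_mod_cast (hω.selected_nonempty hm hne k).card_pos
  have hR1 : 0 ≤ (d * γ + α) * √(2 * Real.log N) := by positivity
  have hR2 : 0 ≤ α * (d + 1) * √(2 * Real.log N) := by positivity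
  -- The constant dominates the gauges of the upper and lower bounds. The final `1` gives the strict
  -- inequality required for transporting the lower bound.
  have hgauge : gaugeConst N d ε γ =
      (d * γ + α) * √(2 * Real.log N) + α * (d + 1) * √(2 * Real.log N) + 1 := rfl
  set C₁ := gaugeConst N d ε γ
  have hC₁ : 0 ≤ C₁ := by linarith
  obtain ⟨C₂, hC₂, hball⟩ := exists_measure_ball_le (μ := μ) (α := α) (c := d * γ)
    (A := 4 ^ (d + 1) * C) (k₀ := k₀) hN hα.le (by positivity) (by positivity) (by
      intro k hk x r hr
      refine (hω.measure_ball_le hb hm hne hμ hk x hr).trans ?_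
      rw [div_le_iff₀ (hZ k)]
      calc (4 : ℝ) ^ (d + 1) = 4 ^ (d + 1) * C *
            Real.exp (d * γ * (Real.log N * k) - α * (Real.log N * triangle k)) *
            (C⁻¹ * Real.exp (α * (Real.log N * triangle k) - d * γ * (Real.log N * k))) := by
            rw [mul_mul_mul_comm, mul_assoc _ C, mul_inv_cancel₀ hC.ne', ← Real.exp_add]
            ring_nf
            simp
        _ ≤ _ := by
            gcongr
            exact (hcard k hk).1)
  have hball' : ∀ x r, 0 < r → (μ : Measure (EuclideanSpace ℝ (Fin d))).real (Metric.ball x r) ≤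
      C₂ * (r ^ α * Phi C₁ (1 / r)) := by
    intro x r hr
    refine (hball x r hr).trans ?_
    gcongr
    exact Phi_mono_left (by linarith) _
  have hcube : (μ : Measure (EuclideanSpace ℝ (Fin d))) (unitCube d)ᶜ = 0 :=
    measure_mono_null (compl_subset_compl.2 (cantorSet_subset_unitCube ω)) hμ.1
  refine ⟨⟨le_antisymm (dimH_cantorSet_le hN hα.le fun k hk => (hcard k hk).2.1)
    (le_dimH_of_measure_ball_le hμ.1 hball' hC₂), fun h0 => ?_⟩,
    ⟨⟨C₂, hC₂, fun x _ r hr => ?_⟩, chartBallCondition_of_measure_ball_le hC₁ hC₂ hcube hball'⟩,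
    fun v₀ hv₀ => ?_⟩
  · exact mutuallySingular_of_isCantorMeasure (c := d * γ * Real.log N) hN (by positivity) hμ
      fun k hk => (hcard k hk).2.2 h0
  · have hr' := Real.rpow_pos_of_pos hr α
    rw [Real.rpow_neg hr.le, ← div_eq_mul_inv, ← div_eq_mul_inv, div_div,
      div_le_iff₀ (mul_pos hr' (Phi_pos _ _))]
    exact hball' x r hr
  · obtain ⟨C₀, hC₀, hlow⟩ := exists_le_measure_ball (μ := μ) (α := α) (B := (4 * C)⁻¹) (v := v₀)
      (k₀ := k₀) hN hα.le (by positivity) (by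
        intro k hk
        have hvk := mem_iInter.1 hv₀ k
        rw [prefractal_eq] at hvk
        simp only [mem_iUnion] at hvk
        obtain ⟨i, hi, hvi⟩ := hvk
        refine ⟨i, hvi, le_trans ?_ (hω.le_measure_cube hb hm hne hμ hk hi)⟩
        rw [Real.exp_neg, ← mul_inv, ← one_div]
        refine one_div_le_one_div_of_le (mul_pos four_pos (hZ k)) ?_
        rw [mul_assoc]
        exact mul_le_mul_of_nonneg_left (hcard k hk).2.1 (by norm_num))
    refine ⟨C₀, hC₀, fun r hr hr1 => (hlow r hr hr1).trans ?_,
      chartLowerCondition_of_le_measure_ball (by linarith) hR2 hlow⟩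
    refine mul_le_mul_of_nonneg_left (Phi_mono_left (by linarith) _) ?_
    exact mul_nonneg measureReal_nonneg (Real.rpow_nonneg hr.le _)

end Main
end RandomCantor

theorem theorem1p7 (n d N : ℕ) (ε γ : ℝ)
    (hn : 2 ≤ n) (hd : 1 ≤ d) (hdn : d ≤ n) (hN : 2 ≤ N)
    (hε₀ : 0 ≤ ε) (hε₁ : ε < 1) (hγ₀ : 0 < γ) (hγ₁ : γ < 1) :
    IsProbabilityMeasure
      (RandomCantor.condProb (RandomCantor.branching N) (RandomCantor.epsSeq ε γ) d) ∧
    (∀ ω : RandomCantor.Sample (RandomCantor.branching N) d,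
      RandomCantor.cantorSet ω ⊆ RandomCantor.unitCube d) ∧
    ∃ (μ : RandomCantor.Sample (RandomCantor.branching N) d →
        ProbabilityMeasure (EuclideanSpace ℝ (Fin d))) (C₁ : ℝ), 0 < C₁ ∧
      ∀ᵐ ω ∂(RandomCantor.condProb (RandomCantor.branching N) (RandomCantor.epsSeq ε γ) d),
        RandomCantor.IsCantorMeasure ω (μ ω) ∧
        -- (a)
        (dimH (RandomCantor.cantorSet ω) = ENNReal.ofReal ((d : ℝ) * (1 - ε)) ∧
          (ε = 0 → (μ ω : Measure (EuclideanSpace ℝ (Fin d))) ⟂ₘ volume)) ∧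
        -- (b)
        ((∃ C₂ : ℝ, 0 < C₂ ∧ ∀ x ∈ RandomCantor.unitCube d, ∀ r : ℝ, 0 < r →
            (μ ω : Measure (EuclideanSpace ℝ (Fin d))).real (Metric.ball x r)
                * r ^ (-((d : ℝ) * (1 - ε))) * (RandomCantor.Phi C₁ (1 / r))⁻¹ ≤ C₂) ∧
          RandomCantor.ChartBallCondition.{v} n d ((d : ℝ) * (1 - ε)) (RandomCantor.Phi C₁)
            (μ ω : Measure (EuclideanSpace ℝ (Fin d)))) ∧
        -- (c)
        (∀ v₀ ∈ RandomCantor.cantorSet ω, ∃ C₀ : ℝ, 0 < C₀ ∧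
          (∀ r : ℝ, 0 < r → r < 1 →
            C₀⁻¹ ≤ (μ ω : Measure (EuclideanSpace ℝ (Fin d))).real (Metric.ball v₀ r)
                * r ^ (-((d : ℝ) * (1 - ε))) * RandomCantor.Phi C₁ (1 / r)) ∧
          RandomCantor.ChartLowerCondition.{v} n d ((d : ℝ) * (1 - ε)) (RandomCantor.Phi C₁)
            (μ ω : Measure (EuclideanSpace ℝ (Fin d))) v₀ C₀⁻¹) := by
  open RandomCantor in
  have hb := branching_pos hN
  have hs := summable_failureBound (γ := γ) hN hd hε₀ hε₁ hγ₀.le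
  have hp : ∀ k, 0 < (selProb (branching N) (epsSeq ε γ) d (k + 1) : ℝ) := fun k => by
    rw [selProb_eq_exp hN hε₀ hγ₀.le]; exact Real.exp_pos _
  have hm : ∀ k, 0 < offspringMean (branching N) (epsSeq ε γ) d k := fun k => by
    rw [offspringMean_eq_exp hN hε₀ hγ₀.le]; exact Real.exp_pos _
  have hL := log_pos_of_two_le hN
  have hε : 0 < 1 - ε := sub_pos.2 hε₁
  refine ⟨cond_isProbabilityMeasure (auxProb_cantorSet_nonempty_ne_zero hb hp hs),
    cantorSet_subset_unitCube, cantorMeasure, gaugeConst N d ε γ, ?_, ?_⟩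
  · unfold gaugeConst
    positivity
  have hE : ∀ᵐ ω ∂(condProb (branching N) (epsSeq ε γ) d), (cantorSet ω).Nonempty :=
    ae_cond_mem (measurableSet_cantorSet_nonempty hb)
  have hc : ∀ᵐ ω ∂(condProb (branching N) (epsSeq ε γ) d),
      ∃ k₀, Controlled (offspringMean (branching N) (epsSeq ε γ) d) k₀ ω :=
    -- Conditioning preserves null sets, so almost sure control passes from `ℙ` to `ℙ*`.
    cond_absolutelyContinuous.ae_le (ae_exists_controlled hs)
  filter_upwards [hE, hc] with ω hωE hω
  obtain ⟨k₀, hω⟩ := hω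
  have hμ := isCantorMeasure_cantorMeasure (hω.exists_isCantorMeasure hb hm
    (tendsto_sideLength_branching hN) ((cantorSet_nonempty_iff hb).1 hωE k₀))
  exact ⟨hμ, cantorSet_properties n hd hN hε₀ hε₁ hγ₀ hω hωE hμ⟩
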